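/- Let $X$ be a finite-dimensional real Euclidean vector space and $\Omega\subset X$ a closed convex cone which is pointed ($-\Omega\cap\Omega=\{0\}$) and solid ($\Omega-\Omega=X$). For $A\subset X$ let $\langle A\rangle$ be its linear span, $\dim A=\dim\langle A\rangle$, $A^*=\{x\in X:\langle x,a\rangle\ge 0\text{ for all }a\in A\}$ the dual cone, and $A^\circledast=\langle A\rangle\cap A^*$ the relative dual cone. Let $\mathbb F(X)$ be the set of all closed subsets of $X$ with the Fell topology, generated by the sets $\{A: A\cap V\neq\varnothing\}$, $V\subset X$ open, and $\{A: A\cap K=\varnothing\}$, $K\subset X$ compact. Let $\overline\Omega$ be the closure of $\{x-\Omega: x\in\Omega\}$ in $\mathbb F(X)$. Let $P\subset\mathbb F(X)$ be the set of non-empty convex faces of $\Omega^*$, and let $n_0<n_1<\dots<n_d$ be the elements of $\{\dim F: F\in P\}$ in increasing order. For $0\le j\le d$ put $$P_j=\{F\in P:\dim F=n_{d-j}\},\qquad Y_j=\{x-F^*: F\in P_j,\ x\in F^\circledast\},$$ and $U_k=\bigcup_{i=0}^{k-1}Y_i$, so that $U_{d+1}=\bigcup_{i=0}^{d}Y_i$.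 For $F\in P$ and $x\in F^\circledast$, the set $x-F^*$ determines $F$ and $x$ uniquely, so $\pi(x-F^*)=F$ and $\lambda(x-F^*)=x$ define maps $\pi:U_{d+1}\to P$ and $\lambda:U_{d+1}\to X$. Then the following hold. (i) If $\overline\Omega=U_{d+1}$, then $P$ is compact. (ii) If $P$ is compact, then the restriction of $(\pi,\lambda):U_{d+1}\to P\times X$ to $Y_j$ is continuous for every $0\le j\le d$. (iii) If $P_j$ is compact for every $0\le j\le d$, then $\overline\Omega=U_{d+1}$. -/

import Mathlib

open scoped Pointwise

namespace WienerHopf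

/-- The space of all closed subsets of `X` (a plain subtype, so that it can carry the Fell
topology; Mathlib's `Closeds` already carries the one of the Hausdorff distance). -/
def ClosedSubset (X : Type*) [TopologicalSpace X] : Type _ := {A : Set X // IsClosed A}

namespace ClosedSubset

variable {X : Type*} [TopologicalSpace X]

/-- The underlying set of points. -/
def carrier (A : ClosedSubset X) : Set X := A.1

instance : CoeOut (ClosedSubset X) (Set X) := ⟨carrier⟩

theorem isClosed (A : ClosedSubset X) : IsClosed (A : Set X) := A.2

theorem ext {A B : ClosedSubset X} (h : (A : Set X) = (B : Set X)) : A = B := Subtype.ext h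

/-- The Fell topology: it is generated by the sets `{A | A ∩ V ≠ ∅}` with `V` open and the sets
`{A | A ∩ K = ∅}` with `K` compact. -/
instance fellTopology : TopologicalSpace (ClosedSubset X) :=
  TopologicalSpace.generateFrom
    ({S | ∃ V : Set X, IsOpen V ∧ S = {A : ClosedSubset X | ((A : Set X) ∩ V).Nonempty}} ∪
     {S | ∃ K : Set X, IsCompact K ∧ S = {A : ClosedSubset X | (A : Set X) ∩ K = ∅}})

end ClosedSubset

theorem isClosed_image_sub {X : Type*} [NormedAddCommGroup X] (x : X) {C : Set X} (hC : IsClosed C) :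
    IsClosed ((fun y => x - y) '' C) :=
  (Homeomorph.subLeft x).isClosedMap C hC

section

variable {X : Type*} [NormedAddCommGroup X] [InnerProductSpace ℝ X]

/-- The dual cone `A^* = {x | ∀ a ∈ A, 0 ≤ ⟪a, x⟫}`. -/
def dualCone (A : Set X) : Set X := (PointedCone.dual (innerₗ X) A : Set X)

theorem mem_dualCone {A : Set X} {x : X} : x ∈ dualCone A ↔ ∀ a ∈ A, 0 ≤ inner ℝ a x := by
  simp [dualCone]

theorem isClosed_dualCone (A : Set X) : IsClosed (dualCone A) := by
  have h : dualCone A = ⋂ a ∈ A, {x : X | 0 ≤ inner ℝ a x} := by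
    ext x
    simp [mem_dualCone]
  rw [h]
  exact isClosed_biInter fun a _ => isClosed_le continuous_const (by fun_prop)

/-- The relative dual cone: the linear span of `A` intersected with the dual cone `A^*`. -/
def relDualCone (A : Set X) : Set X := (Submodule.span ℝ A : Set X) ∩ dualCone A

/-- `dim A`, the dimension of the linear span of `A`. -/
noncomputable def setDim (A : Set X) : ℕ := Module.finrank ℝ (Submodule.span ℝ A)

/-- The closed set `x - A^* = {x - y | y ∈ A^*}`. -/
def subDual (x : X) (A : Set X) : ClosedSubset X :=
  ⟨(fun y => x - y) '' dualCone A, isClosed_image_sub x (isClosed_dualCone A)⟩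

/-- The embedding of points into the closed sets, `x ↦ x - Ω`. -/
def eta (Ω : ProperCone ℝ X) (x : X) : ClosedSubset X :=
  ⟨(fun y => x - y) '' (Ω : Set X), isClosed_image_sub x Ω.isClosed⟩

/-- The closure of (the image of) `Ω` in the space of closed subsets of `X`. -/
def compactification (Ω : ProperCone ℝ X) : Set (ClosedSubset X) :=
  closure (eta Ω '' (Ω : Set X))

/-- `P`: the non-empty convex faces of the dual cone `Ω^*`. (In finite dimension every convex face
of a closed convex set is closed, so taking faces among the closed sets is no restriction.) -/
def faces (Ω : ProperCone ℝ X) : Set (ClosedSubset X) :=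
  {F | (F : Set X).Nonempty ∧ Convex ℝ (F : Set X) ∧
    IsExtreme ℝ (dualCone (Ω : Set X)) (F : Set X)}

/-- The set of dimensions of faces. -/
def faceDims (Ω : ProperCone ℝ X) : Set ℕ :=
  {m | ∃ F ∈ faces Ω, setDim (F : Set X) = m}

variable {d : ℕ}

/-- `P_j`: the faces of dimension `n_{d-j}`. -/
def faceStratum (Ω : ProperCone ℝ X) (n : Fin (d + 1) → ℕ) (j : Fin (d + 1)) :
    Set (ClosedSubset X) :=
  {F | F ∈ faces Ω ∧ setDim (F : Set X) = n j.rev}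

/-- `Y_j`: the sets `x - F^*` with `F ∈ P_j` and `x` in the relative dual cone of `F`. -/
def Y (Ω : ProperCone ℝ X) (n : Fin (d + 1) → ℕ) (j : Fin (d + 1)) : Set (ClosedSubset X) :=
  {A | ∃ F ∈ faceStratum Ω n j, ∃ x ∈ relDualCone (F : Set X), A = subDual x (F : Set X)}

/-- `U_k`: the union of the `Y_i` with `i < k`. -/
def U (Ω : ProperCone ℝ X) (n : Fin (d + 1) → ℕ) (k : ℕ) : Set (ClosedSubset X) :=
  ⋃ (i : Fin (d + 1)) (_ : (i : ℕ) < k), Y Ω n i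

theorem exists_rep {Ω : ProperCone ℝ X} {n : Fin (d + 1) → ℕ} {k : ℕ} (A : U Ω n k) :
    ∃ p : faces Ω × X, p.2 ∈ relDualCone (p.1.1 : Set X) ∧ A.1 = subDual p.2 (p.1.1 : Set X) := by
  obtain ⟨A, hA⟩ := A
  simp only [U, Set.mem_iUnion] at hA
  obtain ⟨i, _, F, hF, x, hx, h⟩ := hA
  exact ⟨(⟨F, hF.1⟩, x), hx, h⟩

/-- The projection `π : U_{d+1} → P`, `π (x - F^*) = F` (see `proj_eq`). -/
noncomputable def facePi (Ω : ProperCone ℝ X) (n : Fin (d + 1) → ℕ) (A : U Ω n (d + 1)) :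
    faces Ω := (exists_rep A).choose.1

/-- The projection `λ : U_{d+1} → X`, `λ (x - F^*) = x` (see `proj_eq`). -/
noncomputable def pointLambda (Ω : ProperCone ℝ X) (n : Fin (d + 1) → ℕ) (A : U Ω n (d + 1)) :
    X := (exists_rep A).choose.2

theorem smul_mem_face {Ω : ProperCone ℝ X} {F : ClosedSubset X} (hF : F ∈ faces Ω) {x : X}
    (hx : x ∈ (F : Set X)) {c : ℝ} (hc : 0 ≤ c) : c • x ∈ (F : Set X) := by
  obtain ⟨-, hconv, hext⟩ := hF
  have hxd := mem_dualCone.1 (hext.1 hx)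
  have key : ∀ t : ℝ, 0 ≤ t → t • x ∈ dualCone (Ω : Set X) := fun t ht =>
    mem_dualCone.2 fun a ha => by
      rw [inner_smul_right]
      exact mul_nonneg ht (hxd a ha)
  have hpos : (c + 2 : ℝ) ≠ 0 := by positivity
  have h0 : (0 : X) ∈ (F : Set X) := by
    refine hext.2 (x := 0) (y := (2 : ℝ) • x) ?_ (key 2 (by norm_num)) hx ?_
    · simpa using key 0 le_rfl
    · refine ⟨1 / 2, 1 / 2, by norm_num, by norm_num, by norm_num, ?_⟩
      rw [smul_zero, zero_add, smul_smul]
      norm_num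
  have h2 : (c + 2) • x ∈ (F : Set X) := by
    refine hext.2 (x := (c + 2) • x) (y := 0) (key _ (by positivity)) ?_ hx ?_
    · simpa using key 0 le_rfl
    · refine ⟨1 / (c + 2), 1 - 1 / (c + 2), by positivity, ?_, by ring, ?_⟩
      · rw [sub_pos, div_lt_one (by positivity)]
        linarith
      · rw [smul_zero, add_zero, smul_smul, one_div_mul_cancel hpos, one_smul]
  have := hconv h2 h0 (a := c / (c + 2)) (b := 2 / (c + 2)) (by positivity) (by positivity)
    (by rw [← add_div, div_self hpos])
  rwa [smul_zero, add_zero, smul_smul, div_mul_cancel₀ c hpos] at this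

theorem dualCone_dualCone [CompleteSpace X] {Ω : ProperCone ℝ X} {F : ClosedSubset X}
    (hF : F ∈ faces Ω) : dualCone (dualCone (F : Set X)) = (F : Set X) := by
  obtain ⟨x₀, hx₀⟩ := hF.1
  have hconv : Convex ℝ (F : Set X) := hF.2.1
  have hadd : ∀ {x y : X}, x ∈ (F : Set X) → y ∈ (F : Set X) → x + y ∈ (F : Set X) := by
    intro x y hx hy
    have h := hconv (smul_mem_face hF hx zero_le_two) (smul_mem_face hF hy zero_le_two)
      (a := 1 / 2) (b := 1 / 2) (by norm_num) (by norm_num) (by norm_num)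
    simpa [smul_smul] using h
  let C : ProperCone ℝ X :=
    { carrier := (F : Set X)
      add_mem' := hadd
      zero_mem' := by simpa using smul_mem_face hF hx₀ le_rfl
      smul_mem' := fun c x hx => smul_mem_face hF hx c.2
      isClosed' := F.isClosed }
  have h := congrArg (fun D : ProperCone ℝ X => (D : Set X)) (ProperCone.innerDual_innerDual C)
  exact h

theorem subset_of_subDual_eq {A B : Set X} {u v : X} (h : subDual u A = subDual v B) :
    dualCone A ⊆ dualCone B := by
  have hs : (fun y => u - y) '' dualCone A = (fun y => v - y) '' dualCone B :=
    congrArg ClosedSubset.carrier h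
  intro z hz
  refine mem_dualCone.2 fun b hb => ?_
  by_contra hneg
  push Not at hneg
  have hk : ∀ k : ℝ, 0 ≤ k → 0 ≤ inner ℝ b (v - u) + k * inner ℝ b z := by
    intro k hk
    have hm : u - k • z ∈ (fun y => u - y) '' dualCone A :=
      ⟨k • z, mem_dualCone.2 fun a ha => by
        rw [inner_smul_right]
        exact mul_nonneg hk (mem_dualCone.1 hz a ha), rfl⟩
    rw [hs] at hm
    obtain ⟨w, hw, hwe⟩ := hm
    have hw' : w = (v - u) + k • z := by
      have : v - w = u - k • z := hwe
      rw [sub_eq_iff_eq_add] at this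
      rw [this]
      abel
    have := mem_dualCone.1 hw b hb
    rwa [hw', inner_add_right, inner_smul_right] at this
  have h0 : 0 ≤ inner ℝ b (v - u) := by simpa using hk 0 le_rfl
  have h1 := hk ((inner ℝ b (v - u) + 1) / (-inner ℝ b z)) (by
    apply div_nonneg <;> linarith)
  have hne : inner ℝ b z ≠ 0 := hneg.ne
  have h2 : (inner ℝ b (v - u) + 1) / (-inner ℝ b z) * inner ℝ b z
      = -(inner ℝ b (v - u) + 1) := by
    field_simp
  linarith

theorem inner_le_of_subDual_eq {A : Set X} {u v : X} (h : subDual u A = subDual v A) {a : X}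
    (ha : a ∈ A) : inner ℝ a u ≤ inner ℝ a v := by
  have hs : (fun y => u - y) '' dualCone A = (fun y => v - y) '' dualCone A :=
    congrArg ClosedSubset.carrier h
  have hm : u ∈ (fun y => u - y) '' dualCone A :=
    ⟨0, mem_dualCone.2 fun a _ => by simp, by simp⟩
  rw [hs] at hm
  obtain ⟨w, hw, rfl⟩ := hm
  have := mem_dualCone.1 hw a ha
  rw [inner_sub_right]
  linarith

/-- `x` and `F` are uniquely determined by `x - F^*`. -/
theorem rep_unique [CompleteSpace X] {Ω : ProperCone ℝ X} {E F : ClosedSubset X} {u v : X}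
    (hE : E ∈ faces Ω) (hF : F ∈ faces Ω) (hu : u ∈ relDualCone (E : Set X))
    (hv : v ∈ relDualCone (F : Set X))
    (h : subDual u (E : Set X) = subDual v (F : Set X)) : E = F ∧ u = v := by
  have hEF : E = F := by
    apply ClosedSubset.ext
    rw [← dualCone_dualCone hE, ← dualCone_dualCone hF,
      (subset_of_subDual_eq h).antisymm (subset_of_subDual_eq h.symm)]
  subst hEF
  refine ⟨rfl, ?_⟩
  have hort : ∀ a ∈ (Submodule.span ℝ (E : Set X)), inner ℝ a (u - v) = 0 := by
    intro a ha
    induction ha using Submodule.span_induction with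
    | mem a ha =>
      have h1 := inner_le_of_subDual_eq h ha
      have h2 := inner_le_of_subDual_eq h.symm ha
      rw [inner_sub_right]
      linarith
    | zero => simp
    | add a b _ _ ha hb => rw [inner_add_left, ha, hb, add_zero]
    | smul c a _ ha => rw [inner_smul_left, ha, mul_zero]
  have := hort (u - v) (Submodule.sub_mem _ hu.1 hv.1)
  exact sub_eq_zero.1 (inner_self_eq_zero.1 this)

/-- The projections satisfy `π (x - F^*) = F` and `λ (x - F^*) = x`. -/
theorem proj_eq [CompleteSpace X] {Ω : ProperCone ℝ X} {n : Fin (d + 1) → ℕ}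
    {A : U Ω n (d + 1)} {F : faces Ω} {x : X} (hx : x ∈ relDualCone (F.1 : Set X))
    (hA : A.1 = subDual x (F.1 : Set X)) : facePi Ω n A = F ∧ pointLambda Ω n A = x := by
  have hs := (exists_rep A).choose_spec
  have h := rep_unique (exists_rep A).choose.1.2 F.2 hs.1 hx (hs.2.symm.trans hA)
  exact ⟨Subtype.ext h.1, h.2⟩

end

end WienerHopf

/-! By `mem_subDual`, x - F^* is cut out by the inequalities ⟨f, a⟩ ≤ ⟨f, x⟩ for f in F, so it is
encoded by the epigraph of ⟨·, x⟩ over F. Limits are taken along ultrafilters, where Fell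
convergence is equality with `limitSet`; `tendsto_subDual` turns convergence of epigraphs into
convergence of the sets x - F^*.

(i) If faces F_i converge to E, then E is a closed cone and -F_i^* tends to -E^*. When the closure
is U_{d+1}, it contains this limit, so -E^* = x - F^* for some face F, and biduality gives E = F.

(ii) On Y_j the dimension is constant. A limit face E contains the expected face F₀, and dimension
cannot grow in the limit, so E = F₀. The points x_i stay bounded, since otherwise a limiting ray
would lie in x₀ - F₀^*; uniqueness of the representation then identifies their limit
(`tendsto_of_setDim_eq`).

(iii) Each x - F^* is in the closure: F is reached from Ω^* by successively exposed faces, and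
adding large multiples of the exposing vector passes from a face to its exposed subface
(`subDual_mem_of_exposed`). Conversely, compact strata make face limits preserve dimension. If x_i
is bounded, the limit epigraph is immediate; if not, the epigraphs over F_i have the same limit as
those over suitable smaller faces, and induction on dimension finishes (`exists_limitSet_epi`). -/

namespace WienerHopf

open Filter Topology

/-! ### Limits of sets along ultrafilters and the Fell topology. -/

section Limits

variable {ι Z : Type*}

/-- The limit, along an ultrafilter, of a family of sets: the points all of whose neighbourhoods
are eventually hit. -/
def limitSet [TopologicalSpace Z] (𝒰 : Ultrafilter ι) (A : ι → Set Z) : Set Z :=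
  {z | ∀ V ∈ 𝓝 z, ∀ᶠ i in 𝒰, (A i ∩ V).Nonempty}

theorem isClosed_limitSet [TopologicalSpace Z] (𝒰 : Ultrafilter ι) (A : ι → Set Z) :
    IsClosed (limitSet 𝒰 A) := by
  refine isClosed_of_closure_subset fun z hz V hV => ?_
  obtain ⟨W, hWV, hWo, hzW⟩ := mem_nhds_iff.1 hV
  obtain ⟨y, hyW, hy⟩ := mem_closure_iff.1 hz W hWo hzW
  exact (hy W (hWo.mem_nhds hyW)).mono fun i hi => hi.mono (Set.inter_subset_inter_right _ hWV)

/-- In a locally compact Hausdorff space, convergence along an ultrafilter in the Fell topology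
means that the limit is `limitSet`. -/
theorem tendsto_fell_iff [TopologicalSpace Z] [LocallyCompactSpace Z] [T2Space Z]
    {𝒰 : Ultrafilter ι} {A : ι → ClosedSubset Z} {B : ClosedSubset Z} :
    Tendsto A 𝒰 (𝓝 B) ↔ limitSet 𝒰 (fun i => (A i : Set Z)) = (B : Set Z) := by
  constructor
  · intro h
    ext z
    constructor
    · intro hz
      by_contra hzB
      obtain ⟨K, hK, hKB, hKc⟩ := local_compact_nhds (B.isClosed.isOpen_compl.mem_nhds hzB)
      have hopen : IsOpen {A : ClosedSubset Z | (A : Set Z) ∩ K = ∅} :=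
        TopologicalSpace.isOpen_generateFrom_of_mem (Or.inr ⟨K, hKc, rfl⟩)
      have hB : (B : Set Z) ∩ K = ∅ :=
        Set.eq_empty_iff_forall_notMem.2 fun y hy => hKB hy.2 hy.1
      obtain ⟨i, h1, h2⟩ := ((h.eventually_mem (hopen.mem_nhds hB)).and (hz K hK)).exists
      exact h2.ne_empty h1
    · intro hz V hV
      obtain ⟨W, hWV, hWo, hzW⟩ := mem_nhds_iff.1 hV
      have hopen : IsOpen {A : ClosedSubset Z | ((A : Set Z) ∩ W).Nonempty} :=
        TopologicalSpace.isOpen_generateFrom_of_mem (Or.inl ⟨W, hWo, rfl⟩)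
      have hB : ((B : Set Z) ∩ W).Nonempty := ⟨z, hz, hzW⟩
      exact (h.eventually_mem (hopen.mem_nhds hB)).mono fun i hi => hi.mono (Set.inter_subset_inter_right _ hWV)
  · intro h
    refine TopologicalSpace.tendsto_nhds_generateFrom_iff.2 ?_
    rintro S (⟨V, hV, rfl⟩ | ⟨K, hK, rfl⟩) hB
    · obtain ⟨z, hz, hzV⟩ := hB
      rw [← h] at hz
      exact hz V (hV.mem_nhds hzV)
    -- Along an ultrafilter, not eventually hitting V means eventually missing V; compactness of K
    -- then needs only finitely many such V.
    · have key : ∀ z ∈ K, ∃ V ∈ 𝓝[K] z, ∀ᶠ i in 𝒰, ¬ ((A i : Set Z) ∩ V).Nonempty := by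
        intro z hz
        have hzB : z ∉ limitSet 𝒰 (fun i => (A i : Set Z)) := by
          rw [h]
          intro hzB
          exact (Set.eq_empty_iff_forall_notMem.1 hB) z ⟨hzB, hz⟩
        simp only [limitSet, Set.mem_ofPred_eq, not_forall] at hzB
        obtain ⟨V, hV, hn⟩ := hzB
        exact ⟨V, mem_nhdsWithin_of_mem_nhds hV, Ultrafilter.eventually_not.2 hn⟩
      have := hK.induction_on (p := fun S => ∀ᶠ i in 𝒰, ¬ ((A i : Set Z) ∩ S).Nonempty)
        (by simp) (fun s t hst ht => ht.mono fun i hi hn => hi (hn.mono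
          (Set.inter_subset_inter_right _ hst)))
        (fun s t hs ht => (hs.and ht).mono fun i hi hn => by
          rw [Set.inter_union_distrib_left, Set.union_nonempty] at hn
          exact hn.elim hi.1 hi.2) key
      exact this.mono fun i hi => Set.not_nonempty_iff_eq_empty.1 hi

theorem mem_limitSet_of_tendsto [TopologicalSpace Z] {𝒰 : Ultrafilter ι} {A : ι → Set Z} {z : Z}
    {a : ι → Z} (ha : ∀ᶠ i in 𝒰, a i ∈ A i) (h : Tendsto a 𝒰 (𝓝 z)) : z ∈ limitSet 𝒰 A :=
  fun _ hV => (ha.and (h hV)).mono fun i hi => ⟨a i, hi⟩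

/-- A point of A i nearest to z serves as the approximating family. -/
theorem mem_limitSet_iff [PseudoMetricSpace Z] [ProperSpace Z] {𝒰 : Ultrafilter ι} {A : ι → Set Z}
    (hA : ∀ᶠ i in 𝒰, IsClosed (A i)) {z : Z} :
    z ∈ limitSet 𝒰 A ↔ ∃ a : ι → Z, (∀ᶠ i in 𝒰, a i ∈ A i) ∧ Tendsto a 𝒰 (𝓝 z) := by
  refine ⟨fun hz => ?_, fun ⟨a, ha, h⟩ => mem_limitSet_of_tendsto ha h⟩
  have hne : ∀ᶠ i in 𝒰, (A i).Nonempty := (hz Set.univ univ_mem).mono fun i hi => by simpa using hi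
  have hex : ∀ i, ∃ a : Z, IsClosed (A i) → (A i).Nonempty → a ∈ A i ∧
      Metric.infDist z (A i) = dist z a := by
    intro i
    by_cases h : IsClosed (A i) ∧ (A i).Nonempty
    · obtain ⟨a, h1, h2⟩ := h.1.exists_infDist_eq_dist h.2 z
      exact ⟨a, fun _ _ => ⟨h1, h2⟩⟩
    · exact ⟨z, fun h1 h2 => absurd ⟨h1, h2⟩ h⟩
  choose a ha using hex
  refine ⟨a, (hA.and hne).mono fun i hi => (ha i hi.1 hi.2).1, Metric.tendsto_nhds.2 ?_⟩
  intro ε hε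
  filter_upwards [hA, hne, hz _ (Metric.ball_mem_nhds z hε)] with i h1 h2 h3
  obtain ⟨y, hy, hyz⟩ := h3
  rw [dist_comm, ← (ha i h1 h2).2]
  refine (Metric.infDist_le_dist_of_mem hy).trans_lt ?_
  rw [dist_comm]
  exact hyz

theorem exists_tendsto_of_bounded [SeminormedAddCommGroup Z] [ProperSpace Z] {𝒰 : Ultrafilter ι}
    {x : ι → Z} {R : ℝ} (h : ∀ᶠ i in 𝒰, ‖x i‖ ≤ R) : ∃ y, Tendsto x 𝒰 (𝓝 y) := by
  obtain ⟨y, -, hy⟩ := (isCompact_closedBall (0 : Z) R).ultrafilter_le_nhds (𝒰.map x)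
    (le_principal_iff.2 (h.mono fun i hi => by simpa using hi))
  exact ⟨y, hy⟩

theorem bounded_or_tendsto_atTop (𝒰 : Ultrafilter ι) (r : ι → ℝ) :
    (∃ R, ∀ᶠ i in 𝒰, r i ≤ R) ∨ Tendsto r 𝒰 atTop := by
  refine or_iff_not_imp_left.2 fun h => tendsto_atTop.2 fun R => ?_
  push Not at h
  exact (h R).mono fun i hi => hi.le

end Limits

/-! ### Convex cones and the faces of Ω^*. -/

section Cones

variable {X : Type*} [NormedAddCommGroup X] [InnerProductSpace ℝ X]

/-- A convex cone, as a predicate on sets. -/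
structure IsCone (C : Set X) : Prop where
  zero_mem : (0 : X) ∈ C
  add_mem : ∀ {x y : X}, x ∈ C → y ∈ C → x + y ∈ C
  smul_mem : ∀ {c : ℝ} {x : X}, 0 ≤ c → x ∈ C → c • x ∈ C

theorem IsCone.convex {C : Set X} (hC : IsCone C) : Convex ℝ C :=
  fun _ hx _ hy _ _ ha hb _ => hC.add_mem (hC.smul_mem ha hx) (hC.smul_mem hb hy)

theorem IsCone.sum_mem {C : Set X} (hC : IsCone C) {ι : Type*} (s : Finset ι) {f : ι → X}
    (h : ∀ i ∈ s, f i ∈ C) : ∑ i ∈ s, f i ∈ C :=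
  Finset.sum_induction f (· ∈ C) (fun _ _ => hC.add_mem) hC.zero_mem h

theorem isCone_dualCone (A : Set X) : IsCone (dualCone A) where
  zero_mem := mem_dualCone.2 fun a _ => by simp
  add_mem hx hy := mem_dualCone.2 fun a ha => by
    rw [inner_add_right]
    exact add_nonneg (mem_dualCone.1 hx a ha) (mem_dualCone.1 hy a ha)
  smul_mem hc hx := mem_dualCone.2 fun a ha => by
    rw [inner_smul_right]
    exact mul_nonneg hc (mem_dualCone.1 hx a ha)

theorem dualCone_anti {A B : Set X} (h : A ⊆ B) : dualCone B ⊆ dualCone A :=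
  fun _ hx => mem_dualCone.2 fun a ha => mem_dualCone.1 hx a (h ha)

theorem isCone_properCone (Ω : ProperCone ℝ X) : IsCone (Ω : Set X) where
  zero_mem := Ω.zero_mem
  add_mem hx hy := Ω.add_mem hx hy
  smul_mem hc hx := Ω.smul_mem hx hc

theorem IsCone.dualCone_dualCone [CompleteSpace X] {C : Set X} (hC : IsCone C)
    (hcl : IsClosed C) : dualCone (dualCone C) = C := by
  let D : ProperCone ℝ X :=
    { carrier := C
      add_mem' := hC.add_mem
      zero_mem' := hC.zero_mem
      smul_mem' := fun c x hx => hC.smul_mem c.2 hx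
      isClosed' := hcl }
  exact congrArg (fun D : ProperCone ℝ X => (D : Set X)) (ProperCone.innerDual_innerDual D)

/-- Moreau decomposition: q is the metric projection of z on C, and its variational inequality is
tested at q + c and at 0. -/
theorem IsCone.exists_moreau [CompleteSpace X] {C : Set X} (hC : IsCone C) (hcl : IsClosed C)
    (z : X) : ∃ q ∈ C, ∃ p ∈ dualCone C, z = q - p ∧ inner ℝ q p = 0 := by
  obtain ⟨q, hq, hmin⟩ := exists_norm_eq_iInf_of_complete_convex ⟨0, hC.zero_mem⟩
    hcl.isComplete hC.convex z
  have h := (norm_eq_iInf_iff_real_inner_le_zero hC.convex hq).1 hmin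
  have h1 : ∀ c ∈ C, inner ℝ (z - q) c ≤ 0 := fun c hc => by
    simpa using h (q + c) (hC.add_mem hq hc)
  have h2 : inner ℝ (z - q) q = 0 := by
    refine le_antisymm (h1 q hq) ?_
    have := h 0 hC.zero_mem
    simpa using this
  refine ⟨q, hq, q - z, mem_dualCone.2 fun a ha => ?_, by abel, ?_⟩
  · have := h1 a ha
    rw [real_inner_comm, ← neg_sub, inner_neg_left]
    linarith
  · rw [real_inner_comm, ← neg_sub, inner_neg_left, h2, neg_zero]

/-- A convex cone in finite dimension has a relative interior point. -/
theorem IsCone.exists_relInterior [FiniteDimensional ℝ X] {C : Set X} (hC : IsCone C) :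
    ∃ f ∈ C, ∃ r > 0, ∀ z ∈ Submodule.span ℝ C, ‖z‖ < r → f - z ∈ C := by
  obtain ⟨b, hbC, hspan, hli⟩ := Submodule.exists_fun_fin_finrank_span_eq ℝ C
  let B := Module.Basis.span hli
  have hcont : Continuous B.equivFun := 
    B.equivFun.toContinuousLinearEquiv.continuous
  obtain ⟨r, hr, h⟩ := Metric.continuous_iff.1 hcont 0 1 one_pos
  -- Subtracting from ∑ b k a vector with all coordinates at most 1 leaves non-negative
  -- coefficients.
  refine ⟨∑ k, b k, hC.sum_mem _ fun k _ => hbC k, r, hr, fun z hz hzr => ?_⟩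
  rw [← hspan] at hz
  have hc := h ⟨z, hz⟩ (by simpa using hzr)
  rw [map_zero, dist_zero_right] at hc
  have hsum := congrArg Subtype.val (B.sum_equivFun ⟨z, hz⟩)
  simp only [Submodule.coe_sum, Submodule.coe_smul, B, Module.Basis.span_apply] at hsum
  rw [← hsum, ← Finset.sum_sub_distrib]
  refine hC.sum_mem _ fun k _ => ?_
  have hk : B.equivFun ⟨z, hz⟩ k ≤ 1 :=
    (le_abs_self _).trans ((norm_le_pi_norm _ k).trans hc.le)
  have := hC.smul_mem (c := 1 - B.equivFun ⟨z, hz⟩ k) (by linarith) (hbC k)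
  rwa [sub_smul, one_smul] at this

theorem exists_pos_smul_norm_lt (x : X) {r : ℝ} (hr : 0 < r) : ∃ ε > (0 : ℝ), ‖ε • x‖ < r := by
  refine ⟨r / (‖x‖ + 1), by positivity, ?_⟩
  rw [norm_smul, Real.norm_of_nonneg (by positivity), div_mul_eq_mul_div, div_lt_iff₀ (by positivity)]
  nlinarith [norm_nonneg x]

/-- The core of `exists_relInterior`, without norms. -/
theorem IsCone.exists_core [FiniteDimensional ℝ X] {C : Set X} (hC : IsCone C) :
    ∃ f ∈ C, ∀ z ∈ Submodule.span ℝ C, ∃ ε > (0 : ℝ), f - ε • z ∈ C := by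
  obtain ⟨f, hf, r, hr, h⟩ := hC.exists_relInterior
  refine ⟨f, hf, fun z hz => ?_⟩
  obtain ⟨ε, hε, hlt⟩ := exists_pos_smul_norm_lt z hr
  exact ⟨ε, hε, h _ (Submodule.smul_mem _ _ hz) hlt⟩

variable {Ω : ProperCone ℝ X}

theorem isCone_face {F : ClosedSubset X} (hF : F ∈ faces Ω) : IsCone (F : Set X) where
  zero_mem := by
    obtain ⟨x, hx⟩ := hF.1
    simpa using smul_mem_face hF hx le_rfl
  add_mem {x y} hx hy := by
    have hconv : Convex ℝ (F : Set X) := hF.2.1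
    have h := hconv (smul_mem_face hF hx zero_le_two) (smul_mem_face hF hy zero_le_two)
      (a := 1 / 2) (b := 1 / 2) (by norm_num) (by norm_num) (by norm_num)
    simpa [smul_smul] using h
  smul_mem hc hx := smul_mem_face hF hx hc

theorem face_subset {F : ClosedSubset X} (hF : F ∈ faces Ω) :
    (F : Set X) ⊆ dualCone (Ω : Set X) := hF.2.2.1

/-- x + y is the midpoint of 2x and 2y. -/
theorem left_mem_face {F : ClosedSubset X} (hF : F ∈ faces Ω) {x y : X}
    (hx : x ∈ dualCone (Ω : Set X)) (hy : y ∈ dualCone (Ω : Set X)) (h : x + y ∈ (F : Set X)) :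
    x ∈ (F : Set X) := by
  have hK := isCone_dualCone (Ω : Set X)
  have h2 : (2 : ℝ) • x ∈ (F : Set X) := by
    refine hF.2.2.2 (hK.smul_mem zero_le_two hx) (hK.smul_mem zero_le_two hy) h
      ⟨1 / 2, 1 / 2, by norm_num, by norm_num, by norm_num, ?_⟩
    simp [smul_smul]
  have := smul_mem_face hF h2 (c := 1 / 2) (by norm_num)
  simpa [smul_smul] using this

theorem mem_faces_of_isCone {F : ClosedSubset X} (hF : IsCone (F : Set X))
    (hsub : (F : Set X) ⊆ dualCone (Ω : Set X))
    (h : ∀ x ∈ dualCone (Ω : Set X), ∀ y ∈ dualCone (Ω : Set X), x + y ∈ (F : Set X) →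
      x ∈ (F : Set X)) : F ∈ faces Ω := by
  refine ⟨⟨0, hF.zero_mem⟩, hF.convex, hsub, fun x hx y hy z hz hseg => ?_⟩
  obtain ⟨a, b, ha, hb, -, rfl⟩ := hseg
  have hK := isCone_dualCone (Ω : Set X)
  have := hF.smul_mem (c := a⁻¹) (by positivity)
    (h _ (hK.smul_mem ha.le hx) _ (hK.smul_mem hb.le hy) hz)
  rwa [smul_smul, inv_mul_cancel₀ ha.ne', one_smul] at this

theorem dualCone_mem_faces :
    (⟨dualCone (Ω : Set X), isClosed_dualCone _⟩ : ClosedSubset X) ∈ faces Ω :=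
  mem_faces_of_isCone (isCone_dualCone _) subset_rfl fun _ hx _ _ _ => hx

theorem mem_face_of_sub_smul_mem {F : ClosedSubset X} (hF : F ∈ faces Ω) {f x : X} {ε : ℝ}
    (hε : 0 < ε) (hf : f ∈ (F : Set X)) (hx : x ∈ dualCone (Ω : Set X))
    (h : f - ε • x ∈ dualCone (Ω : Set X)) : x ∈ (F : Set X) := by
  have h1 := left_mem_face hF ((isCone_dualCone _).smul_mem hε.le hx) h (by simpa using hf)
  have := smul_mem_face hF h1 (c := ε⁻¹) (by positivity)
  rwa [smul_smul, inv_mul_cancel₀ hε.ne', one_smul] at this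

/-- The exposed subface cut out by a vector of the dual cone. -/
theorem exposed_mem_faces {G : ClosedSubset X} (hG : G ∈ faces Ω) {e : X}
    (he : e ∈ dualCone (G : Set X)) :
    ∃ F ∈ faces Ω, ∀ g, g ∈ (F : Set X) ↔ g ∈ (G : Set X) ∧ inner ℝ g e = 0 := by
  have hGc := isCone_face hG
  have hcl : IsClosed {g | g ∈ (G : Set X) ∧ inner ℝ g e = 0} :=
    G.isClosed.inter (isClosed_eq (by fun_prop) continuous_const)
  refine ⟨⟨_, hcl⟩, mem_faces_of_isCone ?_ (fun x hx => face_subset hG hx.1) ?_, fun g => Iff.rfl⟩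
  · refine ⟨⟨hGc.zero_mem, by simp⟩, ?_, ?_⟩
    · rintro x y ⟨hx, hx0⟩ ⟨hy, hy0⟩
      exact ⟨hGc.add_mem hx hy, by rw [inner_add_left, hx0, hy0, add_zero]⟩
    · rintro c x hc ⟨hx, hx0⟩
      exact ⟨hGc.smul_mem hc hx, by rw [real_inner_smul_left, hx0, mul_zero]⟩
  · rintro x hx y hy ⟨h, h0⟩
    have h1 := left_mem_face hG hx hy h
    have h2 := left_mem_face hG hy hx (by rwa [add_comm])
    refine ⟨h1, ?_⟩
    rw [inner_add_left] at h0
    linarith [mem_dualCone.1 he x h1, mem_dualCone.1 he y h2]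

variable [FiniteDimensional ℝ X]

/-- For f in the core of F, f - εx still lies in F, so εx is a summand of f within Ω^*. -/
theorem mem_face_of_mem_span {F : ClosedSubset X} (hF : F ∈ faces Ω) {x : X}
    (hx : x ∈ dualCone (Ω : Set X)) (hs : x ∈ Submodule.span ℝ (F : Set X)) :
    x ∈ (F : Set X) := by
  obtain ⟨f, hf, h⟩ := (isCone_face hF).exists_core
  obtain ⟨ε, hε, hm⟩ := h x hs
  exact mem_face_of_sub_smul_mem hF hε hf hx (face_subset hF hm)

/-- Rigidity: equal dimension forces equal spans, and a face is recovered from its span. -/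
theorem face_subset_of_setDim_le {F : ClosedSubset X} (hF : F ∈ faces Ω) {E : Set X}
    (hE : E ⊆ dualCone (Ω : Set X)) (hFE : (F : Set X) ⊆ E) (h : setDim E ≤ setDim (F : Set X)) :
    E ⊆ (F : Set X) := by
  intro x hx
  refine mem_face_of_mem_span hF (hE hx) ?_
  rw [Submodule.eq_of_le_of_finrank_le (Submodule.span_mono hFE) h]
  exact Submodule.subset_span hx

theorem exists_minimal_face {f : X} (hf : f ∈ dualCone (Ω : Set X)) :
    ∃ H ∈ faces Ω, ∀ g, g ∈ (H : Set X) ↔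
      g ∈ dualCone (Ω : Set X) ∧ ∃ ε > (0 : ℝ), f - ε • g ∈ dualCone (Ω : Set X) := by
  set K := dualCone (Ω : Set X)
  have hK : IsCone K := isCone_dualCone _
  set H : Set X := {g | g ∈ K ∧ ∃ ε > (0 : ℝ), f - ε • g ∈ K}
  have hH : IsCone H := by
    refine ⟨⟨hK.zero_mem, 1, one_pos, by simpa using hf⟩, ?_, ?_⟩
    · rintro x y ⟨hx, ε, hε, h1⟩ ⟨hy, δ, hδ, h2⟩
      refine ⟨hK.add_mem hx hy, (ε⁻¹ + δ⁻¹)⁻¹, by positivity, ?_⟩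
      -- These weights sum to 1 and turn both ε and δ into the common value (ε⁻¹ + δ⁻¹)⁻¹.
      have := hK.add_mem (hK.smul_mem (c := (ε⁻¹ + δ⁻¹)⁻¹ * ε⁻¹) (by positivity) h1)
        (hK.smul_mem (c := (ε⁻¹ + δ⁻¹)⁻¹ * δ⁻¹) (by positivity) h2)
      convert this using 1
      have e1 : (ε⁻¹ + δ⁻¹)⁻¹ * ε⁻¹ + (ε⁻¹ + δ⁻¹)⁻¹ * δ⁻¹ = 1 := by
        rw [← mul_add]
        exact inv_mul_cancel₀ (by positivity)
      have e2 : (ε⁻¹ + δ⁻¹)⁻¹ * ε⁻¹ * ε = (ε⁻¹ + δ⁻¹)⁻¹ := inv_mul_cancel_right₀ hε.ne' _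
      have e3 : (ε⁻¹ + δ⁻¹)⁻¹ * δ⁻¹ * δ = (ε⁻¹ + δ⁻¹)⁻¹ := inv_mul_cancel_right₀ hδ.ne' _
      rw [smul_sub, smul_sub, smul_smul, smul_smul, e2, e3, smul_add, sub_add_sub_comm,
        ← add_smul, e1, one_smul]
    · rintro c x hc ⟨hx, ε, hε, h1⟩
      refine ⟨hK.smul_mem hc hx, ε / (c + 1), by positivity, ?_⟩
      have := hK.add_mem (hK.smul_mem (c := c / (c + 1)) (by positivity) h1)
        (hK.smul_mem (c := 1 / (c + 1)) (by positivity) hf)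
      convert this using 1
      have e1 : c / (c + 1) + 1 / (c + 1) = 1 := by field_simp
      rw [smul_sub, smul_smul, smul_smul, sub_add_eq_add_sub, ← add_smul, e1, one_smul]
      congr 2
      ring
  -- Closedness is not visible from the definition of H; it comes from writing H as Ω^* cut by a
  -- subspace.
  have hspan : H = K ∩ (Submodule.span ℝ H : Set X) := by
    refine Set.Subset.antisymm (fun x hx => ⟨hx.1, Submodule.subset_span hx⟩) ?_
    rintro x ⟨hx, hxs⟩
    obtain ⟨h, hh, hcore⟩ := hH.exists_core
    obtain ⟨ε, hε, hm⟩ := hcore x hxs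
    obtain ⟨-, δ, hδ, hd⟩ := hh
    refine ⟨hx, δ * ε, by positivity, ?_⟩
    have := hK.add_mem hd (hK.smul_mem hδ.le hm.1)
    rwa [smul_sub, smul_smul, sub_add_sub_cancel] at this
  have hcl : IsClosed H := by
    rw [hspan]
    exact (isClosed_dualCone _).inter (Submodule.closed_of_finiteDimensional _)
  refine ⟨⟨H, hcl⟩, mem_faces_of_isCone hH (fun x hx => hx.1) ?_, fun g => Iff.rfl⟩
  rintro x hx y hy ⟨-, ε, hε, h⟩
  refine ⟨hx, ε, hε, ?_⟩
  have := hK.add_mem h (hK.smul_mem hε.le hy)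
  rwa [smul_add, sub_add_eq_sub_sub, sub_add_cancel] at this

/-- A face of a face that is strictly smaller lies in a proper exposed face. -/
theorem exists_exposing {F G : ClosedSubset X} (hF : F ∈ faces Ω) (hG : G ∈ faces Ω)
    (hFG : (F : Set X) ⊆ G) (hne : ¬ (G : Set X) ⊆ F) :
    ∃ e ∈ dualCone (G : Set X), (∀ f ∈ (F : Set X), inner ℝ f e = 0) ∧
      ∃ g ∈ (G : Set X), inner ℝ g e ≠ 0 := by
  set V := Submodule.span ℝ (G : Set X)
  have hGV : ∀ {g : X}, g ∈ (G : Set X) → g ∈ V := fun hg => Submodule.subset_span hg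
  have hGc := isCone_face hG
  let C : Set V := {v | (v : X) ∈ (G : Set X)}
  have hCc : Convex ℝ C := hGc.convex.linear_preimage V.subtype
  obtain ⟨f, hf, hcore⟩ := (isCone_face hF).exists_core
  let f' : V := ⟨f, hGV (hFG hf)⟩
  -- Were f interior to G, every g in G would be a summand of a multiple of f, forcing G ⊆ F.
  have hf' : f' ∉ interior C := by
    intro hi
    obtain ⟨r, hr, hball⟩ := Metric.mem_nhds_iff.1 (mem_interior_iff_mem_nhds.1 hi)
    refine hne fun g hg => ?_
    obtain ⟨ε, hε, hlt⟩ := exists_pos_smul_norm_lt g hr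
    have : f' - ε • (⟨g, hGV hg⟩ : V) ∈ C := hball (by
      rw [Metric.mem_ball, dist_eq_norm, sub_sub_cancel_left, norm_neg]
      exact hlt)
    exact mem_face_of_sub_smul_mem hF hε hf (face_subset hG hg) (face_subset hG this)
  obtain ⟨φ, hφ⟩ := geometric_hahn_banach_open_point hCc.interior isOpen_interior hf'
  obtain ⟨u, hu, r, hr, hur⟩ := hGc.exists_relInterior
  let u' : V := ⟨u, hGV hu⟩
  -- The separation is strict only on the interior, so points of C are pushed inside by a small
  -- multiple of the relative interior point u.
  have hint : ∀ s > (0 : ℝ), ∀ g : V, g ∈ C → s • u' + g ∈ interior C := by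
    intro s hs g hg
    refine mem_interior_iff_mem_nhds.2 (Metric.mem_nhds_iff.2 ⟨s * r, by positivity, fun v hv => ?_⟩)
    have hz := hur (s⁻¹ • (s • u + g - v)) (V.smul_mem _ (V.sub_mem (V.add_mem
      (V.smul_mem _ (hGV hu)) g.2) v.2)) (by
        rw [Metric.mem_ball, dist_comm, dist_eq_norm] at hv
        have hv' : ‖s • u + g - v‖ < s * r := hv
        rw [norm_smul, norm_inv, Real.norm_of_nonneg hs.le, inv_mul_lt_iff₀ hs]
        exact hv')
    have := hGc.add_mem (hGc.smul_mem hs.le hz) hg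
    rw [smul_sub, smul_smul, mul_inv_cancel₀ hs.ne', one_smul] at this
    have e : s • u - (s • u + (g : X) - v) + g = v := by abel
    rwa [e] at this
  have h0 : ∀ s > (0 : ℝ), ∀ g : V, g ∈ C → s * φ u' + φ g < φ f' := fun s hs g hg => by
    simpa using hφ _ (hint s hs g hg)
  have hfnn : 0 ≤ φ f' := by
    refine le_of_forall_pos_lt_add fun δ hδ => ?_
    obtain ⟨s, hs, hlt⟩ := exists_pos_smul_norm_lt (φ u') hδ
    have h1 := h0 s hs 0 (by simpa [C] using hGc.zero_mem)
    rw [map_zero, add_zero] at h1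
    have h2 := (abs_lt.1 hlt).1
    rw [smul_eq_mul] at h2
    linarith
  have hneg : ∀ g : V, g ∈ C → φ g ≤ 0 := by
    intro g hg
    by_contra hpos
    push Not at hpos
    set t := (|φ f'| + |φ u'|) / φ g
    have ht : 0 ≤ t := by positivity
    have h1 := h0 1 one_pos (t • g) (hGc.smul_mem ht hg)
    rw [map_smul, smul_eq_mul, div_mul_cancel₀ _ hpos.ne', one_mul] at h1
    linarith [le_abs_self (φ f'), neg_abs_le (φ u')]
  have hf0 : φ f' = 0 := le_antisymm (hneg _ (hFG hf)) hfnn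
  have hu0 : φ u' < 0 := by
    have := h0 1 one_pos 0 (by simpa [C] using hGc.zero_mem)
    simpa [hf0] using this
  let e : V := -((InnerProductSpace.toDual ℝ V).symm φ)
  have he : ∀ g : V, inner ℝ (g : X) (e : X) = -φ g := fun g => by
    rw [← Submodule.coe_inner, real_inner_comm, inner_neg_left,
      InnerProductSpace.toDual_symm_apply]
  refine ⟨e, mem_dualCone.2 fun g hg => ?_, fun g hg => ?_, u, hu, ?_⟩
  · rw [he ⟨g, hGV hg⟩]
    linarith [hneg ⟨g, hGV hg⟩ hg]
  · have hg' := hGV (hFG hg)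
    rw [he ⟨g, hg'⟩, neg_eq_zero]
    refine le_antisymm (hneg _ (hFG hg)) ?_
    -- φ vanishes at the core point f and is nonpositive at f - εg, hence nonnegative at g.
    obtain ⟨ε, hε, hm⟩ := hcore g (Submodule.subset_span hg)
    have h1 := hneg (f' - ε • ⟨g, hg'⟩) (hFG hm)
    rw [map_sub, hf0, map_smul, smul_eq_mul] at h1
    by_contra hlt
    push Not at hlt
    nlinarith
  · rw [he u']
    exact (neg_pos.2 hu0).ne'

end Cones

/-! ### Epigraphs and convergence of the sets x - F^*. -/

section Duality

variable {ι X : Type*} [NormedAddCommGroup X] [InnerProductSpace ℝ X]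

/-- The epigraph over `F` of the linear form `⟪·, x⟫`. -/
def epi (x : X) (F : Set X) : Set (X × ℝ) := {p | p.1 ∈ F ∧ inner ℝ p.1 x ≤ p.2}

theorem isClosed_epi (x : X) {F : Set X} (hF : IsClosed F) : IsClosed (epi x F) :=
  (hF.preimage continuous_fst).inter (isClosed_le (by fun_prop) continuous_snd)

theorem mem_subDual {x a : X} {F : Set X} :
    a ∈ (subDual x F : Set X) ↔ ∀ f ∈ F, inner ℝ f a ≤ inner ℝ f x := by
  constructor
  · rintro ⟨w, hw, rfl⟩ f hf
    have := mem_dualCone.1 hw f hf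
    rw [inner_sub_right]
    linarith
  · intro h
    refine ⟨x - a, mem_dualCone.2 fun f hf => ?_, sub_sub_cancel _ _⟩
    rw [inner_sub_right]
    linarith [h f hf]

theorem eq_zero_of_mem_span {F : Set X} {v : X} (hv : v ∈ Submodule.span ℝ F)
    (h : ∀ f ∈ F, inner ℝ f v = 0) : v = 0 := by
  have hort : ∀ a ∈ Submodule.span ℝ F, inner ℝ a v = 0 := by
    intro a ha
    induction ha using Submodule.span_induction with
    | mem a ha => exact h a ha
    | zero => simp
    | add a b _ _ ha hb => rw [inner_add_left, ha, hb, add_zero]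
    | smul c a _ ha => rw [inner_smul_left, ha, mul_zero]
  exact inner_self_eq_zero.1 (hort v hv)

variable {𝒰 : Ultrafilter ι}

theorem exists_direction [FiniteDimensional ℝ X] {x : ι → X}
    (h : Tendsto (fun i => ‖x i‖) 𝒰 atTop) :
    ∃ v : X, ‖v‖ = 1 ∧ Tendsto (fun i => ‖x i‖⁻¹ • x i) 𝒰 (𝓝 v) := by
  have hn : ∀ᶠ i in 𝒰, ‖‖x i‖⁻¹ • x i‖ = 1 := by
    filter_upwards [h.eventually_gt_atTop 0] with i hi
    rw [norm_smul, norm_inv, norm_norm, inv_mul_cancel₀ hi.ne']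
  have := FiniteDimensional.proper_real X
  obtain ⟨v, hv⟩ := exists_tendsto_of_bounded (hn.mono fun i hi => hi.le)
  exact ⟨v, tendsto_nhds_unique hv.norm (tendsto_const_nhds.congr' (hn.mono fun i hi => hi.symm)),
    hv⟩

/-- Linear independence is an open condition: a basis drawn from L is approximated by independent
vectors of S i. -/
theorem finrank_span_le_of_tendsto {S : ι → Submodule ℝ X} [FiniteDimensional ℝ X] {L : Set X}
    (hL : ∀ v ∈ L, ∃ a : ι → X, (∀ᶠ i in 𝒰, a i ∈ S i) ∧ Tendsto a 𝒰 (𝓝 v)) {m : ℕ}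
    (hm : ∀ᶠ i in 𝒰, Module.finrank ℝ (S i) ≤ m) :
    Module.finrank ℝ (Submodule.span ℝ L) ≤ m := by
  obtain ⟨b, hbL, -, hli⟩ := Submodule.exists_fun_fin_finrank_span_eq ℝ L
  choose a ha hab using fun k => hL (b k) (hbL k)
  have ht : Tendsto (fun i k => a k i) 𝒰 (𝓝 b) := tendsto_pi_nhds.2 hab
  obtain ⟨i, h1, h2, h3⟩ := ((ht.eventually_mem (isOpen_setOfPred_linearIndependent.mem_nhds hli)).and
    ((eventually_all.2 ha).and hm)).exists
  have hc := finrank_span_eq_card (R := ℝ) (b := fun k => a k i) h1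
  rw [Fintype.card_fin] at hc
  refine le_trans ?_ h3
  rw [← hc]
  refine Submodule.finrank_mono (Submodule.span_le.2 ?_)
  rintro _ ⟨k, rfl⟩
  exact h2 k

variable {F : ι → ClosedSubset X} {x : ι → X} {E : Set X} {y : X}

theorem mem_limitSet_epi [FiniteDimensional ℝ X] {f : X} {t : ℝ} :
    (f, t) ∈ limitSet 𝒰 (fun i => epi (x i) (F i : Set X)) ↔
      ∃ (g : ι → X) (s : ι → ℝ), (∀ᶠ i in 𝒰, g i ∈ (F i : Set X) ∧ inner ℝ (g i) (x i) ≤ s i) ∧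
        Tendsto g 𝒰 (𝓝 f) ∧ Tendsto s 𝒰 (𝓝 t) := by
  have := FiniteDimensional.proper_real X
  rw [mem_limitSet_iff (Eventually.of_forall fun i => isClosed_epi _ (F i).isClosed)]
  constructor
  · rintro ⟨a, ha, h⟩
    exact ⟨fun i => (a i).1, fun i => (a i).2, ha, (continuous_fst.tendsto _).comp h,
      (continuous_snd.tendsto _).comp h⟩
  · rintro ⟨g, s, h, hg, hs⟩
    exact ⟨fun i => (g i, s i), h, hg.prodMk_nhds hs⟩

theorem mem_limitSet_closedSubset [FiniteDimensional ℝ X] {f : X} :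
    f ∈ limitSet 𝒰 (fun i => (F i : Set X)) ↔
      ∃ g : ι → X, (∀ᶠ i in 𝒰, g i ∈ (F i : Set X)) ∧ Tendsto g 𝒰 (𝓝 f) := by
  have := FiniteDimensional.proper_real X
  exact mem_limitSet_iff (Eventually.of_forall fun i => (F i).isClosed)

theorem limitSet_epi_of_tendsto [FiniteDimensional ℝ X]
    (hF : limitSet 𝒰 (fun i => (F i : Set X)) = E) (hx : Tendsto x 𝒰 (𝓝 y)) :
    limitSet 𝒰 (fun i => epi (x i) (F i : Set X)) = epi y E := by
  ext ⟨f, t⟩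
  rw [mem_limitSet_epi]
  constructor
  · rintro ⟨g, s, h, hg, hs⟩
    refine ⟨?_, le_of_tendsto_of_tendsto (hg.inner hx) hs (h.mono fun i hi => hi.2)⟩
    rw [← hF]
    exact mem_limitSet_of_tendsto (h.mono fun i hi => hi.1) hg
  · rintro ⟨hf, hft⟩
    rw [← hF] at hf
    obtain ⟨g, hg, hgf⟩ := mem_limitSet_closedSubset.1 hf
    -- The height t is corrected by the error ⟨g i, x i⟩ - ⟨f, y⟩, which tends to 0.
    refine ⟨g, fun i => t + (inner ℝ (g i) (x i) - inner ℝ f y), hg.mono fun i hi => ⟨hi, ?_⟩,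
      hgf, ?_⟩
    · have hft' : inner ℝ f y ≤ t := hft
      linarith
    · simpa using ((hgf.inner hx).sub_const (inner ℝ f y)).const_add t

variable {Ω : ProperCone ℝ X}

/-- Convergence of the epigraphs implies convergence of the sets `x - F^*`. -/
theorem tendsto_subDual [FiniteDimensional ℝ X] (hF : ∀ᶠ i in 𝒰, F i ∈ faces Ω)
    (hx : ∀ᶠ i in 𝒰, x i ∈ dualCone (F i : Set X))
    (h : limitSet 𝒰 (fun i => epi (x i) (F i : Set X)) = epi y E) :
    Tendsto (fun i => subDual (x i) (F i : Set X)) 𝒰 (𝓝 (subDual y E)) := by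
  have := FiniteDimensional.proper_real X
  rw [tendsto_fell_iff]
  ext a
  constructor
  · intro ha
    obtain ⟨b, hb, hba⟩ := mem_limitSet_closedSubset.1 ha
    refine mem_subDual.2 fun f hf => ?_
    have hft : (f, inner ℝ f y) ∈ epi y E := ⟨hf, le_rfl⟩
    rw [← h] at hft
    obtain ⟨g, s, hgs, hg, hs⟩ := mem_limitSet_epi.1 hft
    exact le_of_tendsto_of_tendsto (hg.inner hba) hs
      ((hgs.and hb).mono fun i hi => (mem_subDual.1 hi.2 _ hi.1.1).trans hi.1.2)
  · intro ha
    -- Moreau decomposition of a - x i gives a - q i = x i - p i in x i - (F i)^*; it remains to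
    -- show q i → 0.
    have hex : ∀ i, ∃ q p : X, F i ∈ faces Ω → q ∈ (F i : Set X) ∧ p ∈ dualCone (F i : Set X) ∧
        a - x i = q - p ∧ inner ℝ q p = 0 := by
      intro i
      by_cases hi : F i ∈ faces Ω
      · obtain ⟨q, hq, p, hp, h1, h2⟩ := (isCone_face hi).exists_moreau (F i).isClosed (a - x i)
        exact ⟨q, p, fun _ => ⟨hq, hp, h1, h2⟩⟩
      · exact ⟨0, 0, fun h => absurd h hi⟩
    choose q p hqp using hex
    have hqx : ∀ᶠ i in 𝒰, inner ℝ (q i) (x i) = inner ℝ (q i) a - inner ℝ (q i) (q i) := by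
      filter_upwards [hF] with i hi
      obtain ⟨-, -, h1, h2⟩ := hqp i hi
      have : x i = a - q i + p i := by
        rw [sub_eq_iff_eq_add] at h1
        rw [h1]
        abel
      rw [this, inner_add_right, inner_sub_right, h2, add_zero]
    have hbd : ∀ᶠ i in 𝒰, ‖q i‖ ≤ ‖a‖ := by
      filter_upwards [hF, hx, hqx] with i hi hxi hqi
      have h1 := mem_dualCone.1 hxi (q i) (hqp i hi).1
      rw [hqi, real_inner_self_eq_norm_sq] at h1
      have h2 := real_inner_le_norm (q i) a
      by_contra hlt
      push Not at hlt
      nlinarith [norm_nonneg a]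
    obtain ⟨z, hz⟩ := exists_tendsto_of_bounded hbd
    -- The limit z of q satisfies ⟨z, y⟩ ≤ ⟨z, a⟩ - ‖z‖², whereas a in y - E^* gives ⟨z, a⟩ ≤ ⟨z,
    -- y⟩; thus z = 0.
    have hmem : (z, inner ℝ z a - inner ℝ z z) ∈ epi y E := by
      rw [← h, mem_limitSet_epi]
      exact ⟨q, fun i => inner ℝ (q i) a - inner ℝ (q i) (q i), (hF.and hqx).mono fun i hi =>
        ⟨(hqp i hi.1).1, hi.2.le⟩, hz, (hz.inner tendsto_const_nhds).sub (hz.inner hz)⟩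
    have hz0 : z = 0 := by
      have h1 := mem_subDual.1 ha z hmem.1
      have h2 : inner ℝ z y ≤ inner ℝ z a - inner ℝ z z := hmem.2
      have h3 := real_inner_self_nonneg (x := z)
      exact (inner_self_eq_zero (𝕜 := ℝ)).1 (by linarith)
    have hlim : Tendsto (fun i => a - q i) 𝒰 (𝓝 a) := by
      simpa [hz0] using (tendsto_const_nhds (x := a)).sub hz
    refine mem_limitSet_of_tendsto (hF.mono fun i hi => ?_) hlim
    obtain ⟨-, hp, h1, -⟩ := hqp i hi
    refine ⟨p i, hp, ?_⟩
    rw [sub_eq_iff_eq_add] at h1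
    simp only [h1]
    abel

section Limits

variable [FiniteDimensional ℝ X]

theorem mem_dualCone_of_tendsto (hF : limitSet 𝒰 (fun i => (F i : Set X)) = E)
    (hx : ∀ᶠ i in 𝒰, x i ∈ dualCone (F i : Set X))
    (h : Tendsto x 𝒰 (𝓝 y)) : y ∈ dualCone E := by
  refine mem_dualCone.2 fun f hf => ?_
  rw [← hF] at hf
  obtain ⟨g, hg, hgf⟩ := mem_limitSet_closedSubset.1 hf
  exact ge_of_tendsto (hgf.inner h) ((hx.and hg).mono fun i hi => mem_dualCone.1 hi.1 _ hi.2)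

theorem setDim_limitSet_le (hF : limitSet 𝒰 (fun i => (F i : Set X)) = E) {m : ℕ}
    (hm : ∀ᶠ i in 𝒰, setDim (F i : Set X) ≤ m) : setDim E ≤ m := by
  refine finrank_span_le_of_tendsto (𝒰 := 𝒰) (S := fun i => Submodule.span ℝ (F i : Set X))
    (fun v hv => ?_) hm
  rw [← hF] at hv
  obtain ⟨g, hg, hgf⟩ := mem_limitSet_closedSubset.1 hv
  exact ⟨g, hg.mono fun i hi => Submodule.subset_span hi, hgf⟩

/-- Adjoining y to E cannot raise the dimension above that of the F i, so y lies in the span of E.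
Without constant dimension this can fail. -/
theorem mem_relDualCone_of_tendsto (hF : limitSet 𝒰 (fun i => (F i : Set X)) = E)
    (hdim : ∀ᶠ i in 𝒰, setDim (F i : Set X) = setDim E)
    (hx : ∀ᶠ i in 𝒰, x i ∈ relDualCone (F i : Set X))
    (h : Tendsto x 𝒰 (𝓝 y)) : y ∈ relDualCone E := by
  refine ⟨?_, mem_dualCone_of_tendsto hF (hx.mono fun i hi => hi.2) h⟩
  have hle : Module.finrank ℝ (Submodule.span ℝ (insert y E)) ≤ setDim E := by
    refine finrank_span_le_of_tendsto (𝒰 := 𝒰) (S := fun i => Submodule.span ℝ (F i : Set X))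
      (fun v hv => ?_) (hdim.mono fun i hi => hi.le)
    rcases hv with rfl | hv
    · exact ⟨x, hx.mono fun i hi => hi.1, h⟩
    rw [← hF] at hv
    obtain ⟨g, hg, hgf⟩ := mem_limitSet_closedSubset.1 hv
    exact ⟨g, hg.mono fun i hi => Submodule.subset_span hi, hgf⟩
  rw [SetLike.mem_coe,
    Submodule.eq_of_le_of_finrank_le (Submodule.span_mono (Set.subset_insert y E)) hle]
  exact Submodule.subset_span (Set.mem_insert y E)

theorem direction_mem_relDualCone (hF : limitSet 𝒰 (fun i => (F i : Set X)) = E)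
    (hdim : ∀ᶠ i in 𝒰, setDim (F i : Set X) = setDim E)
    (hx : ∀ᶠ i in 𝒰, x i ∈ relDualCone (F i : Set X))
    (h : Tendsto (fun i => ‖x i‖⁻¹ • x i) 𝒰 (𝓝 y)) : y ∈ relDualCone E :=
  mem_relDualCone_of_tendsto hF hdim (hx.mono fun i hi => ⟨Submodule.smul_mem _ _ hi.1,
    (isCone_dualCone _).smul_mem (by positivity) hi.2⟩) h

end Limits

end Duality

/-! ### Compactness of the faces and continuity on the strata: parts (i) and (ii). -/

section Compactification

variable {ι X : Type*} [NormedAddCommGroup X] [InnerProductSpace ℝ X]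

theorem limitSet_mono {Z : Type*} [TopologicalSpace Z] {𝒰 : Ultrafilter ι} {A B : ι → Set Z}
    (h : ∀ᶠ i in 𝒰, A i ⊆ B i) : limitSet 𝒰 A ⊆ limitSet 𝒰 B :=
  fun _ hz V hV => (h.and (hz V hV)).mono fun _ hi =>
    hi.2.mono (Set.inter_subset_inter_left _ hi.1)

theorem fell_tendsto_unique {Z : Type*} [TopologicalSpace Z] [LocallyCompactSpace Z] [T2Space Z]
    {𝒰 : Ultrafilter ι} {A : ι → ClosedSubset Z} {B C : ClosedSubset Z}
    (hB : Tendsto A 𝒰 (𝓝 B)) (hC : Tendsto A 𝒰 (𝓝 C)) : B = C :=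
  ClosedSubset.ext ((tendsto_fell_iff.1 hB).symm.trans (tendsto_fell_iff.1 hC))

theorem nonpos_of_mul_le {l : Filter ι} [NeBot l] {t a c : ι → ℝ} {α γ : ℝ}
    (ht : Tendsto t l atTop) (ha : Tendsto a l (𝓝 α)) (hc : Tendsto c l (𝓝 γ))
    (h : ∀ᶠ i in l, t i * a i ≤ c i) : α ≤ 0 := by
  by_contra hα
  push Not at hα
  exact not_tendsto_atTop_of_tendsto_nhds hc (tendsto_atTop_mono' l h (ht.atTop_mul_pos hα ha))

theorem nonpos_of_forall_mul_le {a c : ℝ} (h : ∀ s : ℝ, 0 ≤ s → s * a ≤ c) : a ≤ 0 :=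
  nonpos_of_mul_le (l := atTop) (t := id) tendsto_id tendsto_const_nhds tendsto_const_nhds
    ((eventually_ge_atTop 0).mono h)

theorem epi_congr {F : Set X} {x y : X} (h : ∀ f ∈ F, inner ℝ f x = inner ℝ f y) :
    epi x F = epi y F :=
  Set.ext fun p => and_congr_right fun hp => by rw [h _ hp]

theorem exists_mem_relDualCone [FiniteDimensional ℝ X] {F : Set X} {x : X} (hx : x ∈ dualCone F) :
    ∃ y ∈ relDualCone F, ∀ f ∈ F, inner ℝ f x = inner ℝ f y := by
  obtain ⟨y, hy, z, hz, rfl⟩ := (Submodule.span ℝ F).exists_add_mem_mem_orthogonal x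
  have h : ∀ f ∈ F, inner ℝ f (y + z) = inner ℝ f y := fun f hf => by
    rw [inner_add_right, Submodule.inner_right_of_mem_orthogonal (Submodule.subset_span hf) hz,
      add_zero]
  exact ⟨y, ⟨hy, mem_dualCone.2 fun f hf => h f hf ▸ mem_dualCone.1 hx f hf⟩, h⟩

theorem exists_inner_pos {F : Set X} {v : X} (hv : v ∈ relDualCone F) (h0 : v ≠ 0) :
    ∃ f ∈ F, 0 < inner ℝ f v := by
  by_contra h
  push Not at h
  exact h0 (eq_zero_of_mem_span hv.1 fun f hf => le_antisymm (h f hf) (mem_dualCone.1 hv.2 f hf))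

variable {Ω : ProperCone ℝ X} {d : ℕ} {n : Fin (d + 1) → ℕ}

theorem mem_U_iff (hdims : Set.range n = faceDims Ω) {A : ClosedSubset X} :
    A ∈ U Ω n (d + 1) ↔
      ∃ F ∈ faces Ω, ∃ x ∈ relDualCone (F : Set X), A = subDual x (F : Set X) := by
  simp only [U, Set.mem_iUnion]
  constructor
  · rintro ⟨i, _, F, hF, x, hx, h⟩
    exact ⟨F, hF.1, x, hx, h⟩
  · rintro ⟨F, hF, x, hx, h⟩
    obtain ⟨j, hj⟩ : setDim (F : Set X) ∈ Set.range n := hdims ▸ ⟨F, hF, rfl⟩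
    exact ⟨j.rev, j.rev.2, F, ⟨hF, by rw [Fin.rev_rev, hj]⟩, x, hx, h⟩

theorem zero_mem_relDualCone (F : Set X) : (0 : X) ∈ relDualCone F :=
  ⟨Submodule.zero_mem _, (isCone_dualCone F).zero_mem⟩

variable [FiniteDimensional ℝ X]

theorem isCone_limitSet {𝒰 : Ultrafilter ι} {F : ι → ClosedSubset X}
    (hF : ∀ᶠ i in 𝒰, F i ∈ faces Ω) : IsCone (limitSet 𝒰 fun i => (F i : Set X)) where
  zero_mem := mem_limitSet_closedSubset.2
    ⟨fun _ => 0, hF.mono fun i hi => (isCone_face hi).zero_mem, tendsto_const_nhds⟩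
  add_mem hx hy := by
    obtain ⟨a, ha, hax⟩ := mem_limitSet_closedSubset.1 hx
    obtain ⟨b, hb, hby⟩ := mem_limitSet_closedSubset.1 hy
    exact mem_limitSet_closedSubset.2 ⟨fun i => a i + b i, (hF.and (ha.and hb)).mono fun i hi =>
      (isCone_face hi.1).add_mem hi.2.1 hi.2.2, hax.add hby⟩
  smul_mem {c x} hc hx := by
    obtain ⟨a, ha, hax⟩ := mem_limitSet_closedSubset.1 hx
    exact mem_limitSet_closedSubset.2 ⟨fun i => c • a i, (hF.and ha).mono fun i hi =>
      (isCone_face hi.1).smul_mem hc hi.2, hax.const_smul c⟩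

theorem tendsto_subDual_zero {𝒰 : Ultrafilter ι} {F : ι → ClosedSubset X}
    (hF : ∀ᶠ i in 𝒰, F i ∈ faces Ω) {E : Set X}
    (hE : limitSet 𝒰 (fun i => (F i : Set X)) = E) :
    Tendsto (fun i => subDual 0 (F i : Set X)) 𝒰 (𝓝 (subDual 0 E)) :=
  tendsto_subDual (x := fun _ => 0) hF
    (Eventually.of_forall fun i => (zero_mem_relDualCone (F i : Set X)).2)
    (limitSet_epi_of_tendsto hE tendsto_const_nhds)

/-- If the closure consists of the sets `x - F^*`, then the space of faces is compact. -/
theorem isCompact_faces (hdims : Set.range n = faceDims Ω)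
    (h : compactification Ω = U Ω n (d + 1)) : IsCompact (faces Ω) := by
  refine isCompact_iff_ultrafilter_le_nhds.2 fun 𝒰 h𝒰 => ?_
  have hF : ∀ᶠ F in 𝒰, F ∈ faces Ω := le_principal_iff.1 h𝒰
  have := FiniteDimensional.proper_real X
  -- E is a closed convex cone; that it is a face is only deduced at the end, from the hypothesis on
  -- the closure.
  let E : ClosedSubset X := ⟨limitSet 𝒰 fun F => (F : Set X), isClosed_limitSet _ _⟩
  have hE : Tendsto id 𝒰 (𝓝 E) := tendsto_fell_iff.2 rfl
  have hmem : subDual 0 (E : Set X) ∈ compactification Ω := by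
    refine isClosed_closure.mem_of_tendsto (tendsto_subDual_zero (F := id) hF rfl)
      (hF.mono fun F hF => ?_)
    change _ ∈ compactification Ω
    rw [h, mem_U_iff hdims]
    exact ⟨F, hF, 0, zero_mem_relDualCone _, rfl⟩
  rw [h, mem_U_iff hdims] at hmem
  obtain ⟨F, hFf, x, -, hx⟩ := hmem
  have hdual : dualCone (E : Set X) = dualCone (F : Set X) :=
    (subset_of_subDual_eq hx).antisymm (subset_of_subDual_eq hx.symm)
  have hEF : E = F := by
    apply ClosedSubset.ext
    have hEE : dualCone (dualCone (E : Set X)) = E :=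
      (isCone_limitSet (F := id) hF).dualCone_dualCone (isClosed_limitSet _ _)
    rw [← hEE, hdual, dualCone_dualCone hFf]
  exact ⟨F, hFf, hEF ▸ hE⟩

/-- Convergence of sets `x - F^*` with `F` of constant dimension. -/
theorem tendsto_of_setDim_eq {𝒰 : Ultrafilter ι} {F : ι → ClosedSubset X} {x : ι → X}
    {E F₀ : ClosedSubset X} {x₀ : X} (hF : ∀ᶠ i in 𝒰, F i ∈ faces Ω)
    (hx : ∀ᶠ i in 𝒰, x i ∈ relDualCone (F i : Set X)) (hF₀ : F₀ ∈ faces Ω)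
    (hx₀ : x₀ ∈ relDualCone (F₀ : Set X))
    (hdim : ∀ᶠ i in 𝒰, setDim (F i : Set X) = setDim (F₀ : Set X))
    (h : Tendsto (fun i => subDual (x i) (F i : Set X)) 𝒰 (𝓝 (subDual x₀ (F₀ : Set X))))
    (hE : E ∈ faces Ω) (hFE : limitSet 𝒰 (fun i => (F i : Set X)) = E) :
    E = F₀ ∧ Tendsto x 𝒰 (𝓝 x₀) := by
  have := FiniteDimensional.proper_real X
  have hlim := tendsto_fell_iff.1 h
  -- Since x i lies in (F i)^*, -(F i)^* is contained in x i - (F i)^*; pass to the limit.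
  have hsub : (subDual 0 (E : Set X) : Set X) ⊆ subDual x₀ (F₀ : Set X) := by
    rw [← hlim, ← tendsto_fell_iff.1 (tendsto_subDual_zero hF hFE)]
    refine limitSet_mono (hx.mono fun i hi a ha => mem_subDual.2 fun f hf => ?_)
    have h1 := mem_subDual.1 ha f hf
    rw [inner_zero_right] at h1
    exact h1.trans (mem_dualCone.1 hi.2 f hf)
  have hF₀E : (F₀ : Set X) ⊆ E := by
    intro f hf
    rw [← dualCone_dualCone hE]
    refine mem_dualCone.2 fun p hp => ?_
    refine neg_nonpos.1 (nonpos_of_forall_mul_le (c := inner ℝ f x₀) fun s hs => ?_)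
    have h1 : -(s • p) ∈ (subDual 0 (E : Set X) : Set X) := mem_subDual.2 fun g hg => by
      rw [inner_neg_right, inner_smul_right, inner_zero_right]
      exact neg_nonpos.2 (mul_nonneg hs (mem_dualCone.1 hp g hg))
    have h2 := mem_subDual.1 (hsub h1) f hf
    rw [inner_neg_right, inner_smul_right, real_inner_comm] at h2
    linarith
  have hEF₀ : E = F₀ := ClosedSubset.ext ((face_subset_of_setDim_le hF₀ (face_subset hE) hF₀E
    (setDim_limitSet_le hFE (hdim.mono fun i hi => hi.le))).antisymm hF₀E)
  subst hEF₀
  refine ⟨rfl, ?_⟩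
  rcases bounded_or_tendsto_atTop 𝒰 fun i => ‖x i‖ with ⟨R, hR⟩ | htop
  · obtain ⟨y, hy⟩ := exists_tendsto_of_bounded hR
    have hyE := mem_relDualCone_of_tendsto hFE hdim hx hy
    have h2 := fell_tendsto_unique h (tendsto_subDual hF (hx.mono fun i hi => hi.2)
      (limitSet_epi_of_tendsto hFE hy))
    rwa [(rep_unique hE hE hx₀ hyE h2).2]
  · obtain ⟨v, hv1, hv⟩ := exists_direction htop
    have hvE := direction_mem_relDualCone hFE hdim hx hv
    obtain ⟨f, hf, hpos⟩ := exists_inner_pos hvE (by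
      rintro rfl
      simp at hv1)
    -- If x i is unbounded with limiting direction v, the whole ray s • v lies in x₀ - E^*, so ⟨f,
    -- v⟩ ≤ 0, against the choice of f.
    refine absurd (nonpos_of_forall_mul_le (c := inner ℝ f x₀) fun s hs => ?_) (not_le.2 hpos)
    have h1 : s • v ∈ (subDual x₀ (E : Set X) : Set X) := by
      rw [← hlim]
      refine mem_limitSet_of_tendsto ?_ (hv.const_smul s)
      filter_upwards [hx, htop.eventually_ge_atTop s, htop.eventually_gt_atTop 0] with i h1 h2 h3
      refine mem_subDual.2 fun g hg => ?_
      rw [inner_smul_right, inner_smul_right, ← mul_assoc]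
      refine mul_le_of_le_one_left (mem_dualCone.1 h1.2 g hg) ?_
      rw [← div_eq_mul_inv]
      exact (div_le_one h3).2 h2
    have h2 := mem_subDual.1 h1 f hf
    rwa [inner_smul_right] at h2

/-- Continuity is tested on ultrafilters within Y_j: compactness supplies a limit face, and
constancy of dimension permits `tendsto_of_setDim_eq`. -/
theorem continuousOn_facePi_pointLambda (h : IsCompact (faces Ω)) (j : Fin (d + 1)) :
    ContinuousOn (fun A : U Ω n (d + 1) => (facePi Ω n A, pointLambda Ω n A))
      {A | A.1 ∈ Y Ω n j} := by
  intro A₀ hA₀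
  refine tendsto_iff_ultrafilter _ _ _ |>.2 fun 𝒰 h𝒰 => ?_
  have hspec : ∀ A : U Ω n (d + 1), pointLambda Ω n A ∈ relDualCone ((facePi Ω n A).1 : Set X) ∧
      A.1 = subDual (pointLambda Ω n A) ((facePi Ω n A).1 : Set X) :=
    fun A => (exists_rep A).choose_spec
  have hY : ∀ A : U Ω n (d + 1), A.1 ∈ Y Ω n j →
      setDim ((facePi Ω n A).1 : Set X) = n j.rev := by
    rintro A ⟨F, hF, x, hx, hA⟩
    rw [(proj_eq (F := ⟨F, hF.1⟩) hx hA).1]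
    exact hF.2
  have hin : ∀ᶠ A : U Ω n (d + 1) in 𝒰, A.1 ∈ Y Ω n j := h𝒰 self_mem_nhdsWithin
  have hlim : Tendsto (fun A : U Ω n (d + 1) => A.1) 𝒰 (𝓝 A₀.1) :=
    (continuous_subtype_val.tendsto A₀).mono_left (h𝒰.trans nhdsWithin_le_nhds)
  have hF : ∀ᶠ A in 𝒰, (facePi Ω n A).1 ∈ faces Ω := Eventually.of_forall fun A => (facePi Ω n A).2
  obtain ⟨E, hE, hle⟩ := h.ultrafilter_le_nhds (𝒰.map fun A => (facePi Ω n A).1)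
    (le_principal_iff.2 hF)
  have hle' : Tendsto (fun A => (facePi Ω n A).1) 𝒰 (𝓝 E) := hle
  have := FiniteDimensional.proper_real X
  obtain ⟨hEF, hx⟩ := tendsto_of_setDim_eq (𝒰 := 𝒰) (F := fun A => (facePi Ω n A).1)
    (x := pointLambda Ω n) hF (Eventually.of_forall fun A => (hspec A).1) (facePi Ω n A₀).2
    (hspec A₀).1 (hin.mono fun A hA => (hY A hA).trans (hY A₀ hA₀).symm)
    (by
      rw [← (hspec A₀).2]
      exact hlim.congr fun A => (hspec A).2) hE (tendsto_fell_iff.1 hle')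
  subst hEF
  exact (tendsto_subtype_rng.2 hle').prodMk_nhds hx

end Compactification

/-! ### Description of the closure: part (iii). -/

section Closure

variable {ι X : Type*} [NormedAddCommGroup X] [InnerProductSpace ℝ X] [FiniteDimensional ℝ X]
  {Ω : ProperCone ℝ X}

/-- A core point u of Ω works: u - εf lies in Ω, so ⟨f, u⟩ ≥ ε‖f‖². -/
theorem exists_inner_pos_of_solid (hsolid : (Ω : Set X) - (Ω : Set X) = Set.univ) :
    ∃ u : X, ∀ f ∈ dualCone (Ω : Set X), f ≠ 0 → 0 < inner ℝ f u := by
  obtain ⟨u, -, hcore⟩ := (isCone_properCone Ω).exists_core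
  refine ⟨u, fun f hf h0 => ?_⟩
  have hspan : f ∈ Submodule.span ℝ (Ω : Set X) := by
    obtain ⟨a, ha, b, hb, rfl⟩ := Set.mem_sub.1 (hsolid ▸ Set.mem_univ f)
    exact Submodule.sub_mem _ (Submodule.subset_span ha) (Submodule.subset_span hb)
  obtain ⟨ε, hε, hm⟩ := hcore f hspan
  have h1 := mem_dualCone.1 hf _ hm
  rw [inner_sub_left, real_inner_smul_left, real_inner_comm] at h1
  have h2 : 0 < inner ℝ f f := real_inner_self_pos.2 h0
  have := mul_pos hε h2
  linarith

/-- A vector that is positive on the exposed face `G ∩ e^⊥` becomes positive on `G` after adding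
a large multiple of `e`. -/
theorem exists_add_smul_mem_dualCone {G : ClosedSubset X} (hG : IsCone (G : Set X)) {e w : X}
    (he : e ∈ dualCone (G : Set X))
    (hw : ∀ f ∈ (G : Set X), inner ℝ f e = 0 → f ≠ 0 → 0 < inner ℝ f w) (N : ℝ) :
    ∃ t ≥ N, w + t • e ∈ dualCone (G : Set X) := by
  by_contra hcon
  push Not at hcon
  have hex : ∀ k : ℕ, ∃ f ∈ (G : Set X), ‖f‖ = 1 ∧ inner ℝ f w + (N + k) * inner ℝ f e < 0 := by
    intro k
    have h1 := hcon (N + k) (by simp)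
    rw [mem_dualCone] at h1
    push Not at h1
    obtain ⟨f, hf, hlt⟩ := h1
    rw [inner_add_right, inner_smul_right] at hlt
    have hf0 : f ≠ 0 := by
      rintro rfl
      simp at hlt
    have hn : 0 < ‖f‖ := norm_pos_iff.2 hf0
    refine ⟨‖f‖⁻¹ • f, hG.smul_mem (by positivity) hf, ?_, ?_⟩
    · rw [norm_smul, norm_inv, norm_norm, inv_mul_cancel₀ hn.ne']
    · rw [real_inner_smul_left, real_inner_smul_left, mul_left_comm, ← mul_add]
      exact mul_neg_of_pos_of_neg (by positivity) hlt
  choose f hfG hf1 hlt using hex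
  have := FiniteDimensional.proper_real X
  obtain ⟨z, hz⟩ := exists_tendsto_of_bounded (𝒰 := hyperfilter ℕ) (x := f) (R := 1)
    (Eventually.of_forall fun k => (hf1 k).le)
  have hz1 : ‖z‖ = 1 := tendsto_nhds_unique hz.norm (by simp [hf1])
  have hzG : z ∈ (G : Set X) := G.isClosed.mem_of_tendsto hz (Eventually.of_forall hfG)
  have ht : Tendsto (fun k : ℕ => N + k) (hyperfilter ℕ) atTop :=
    (tendsto_atTop_add_const_left _ N tendsto_natCast_atTop_atTop).mono_left
      Nat.hyperfilter_le_atTop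
  -- The products (N + k)⟨f k, e⟩ are bounded above, so the unit limit z lies on G ∩ e^⊥; yet ⟨z, w⟩
  -- ≤ 0, contradicting `hw`.
  have hze : inner ℝ z e ≤ 0 := nonpos_of_mul_le ht (hz.inner tendsto_const_nhds)
    (hz.inner (tendsto_const_nhds (x := w))).neg
    (Eventually.of_forall fun k => by linarith [hlt k])
  have hzw : inner ℝ z w ≤ 0 := by
    refine le_of_tendsto (hz.inner tendsto_const_nhds) ?_
    filter_upwards [ht.eventually_ge_atTop 0] with k hk
    linarith [hlt k, mul_nonneg hk (mem_dualCone.1 he _ (hfG k))]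
  refine absurd hzw (not_le.2 (hw z hzG (le_antisymm hze (mem_dualCone.1 he z hzG)) ?_))
  rintro rfl
  simp at hz1

/-- The multiples t k • e act as a penalty: in the limit ⟨·, t k • e⟩ is infinite off e^⊥ and 0 on
it, so epigraphs over G converge to the one over E. The term u / (k + 1) makes x strictly positive
on E minus 0, so that the perturbed points lie in G^*. -/
theorem subDual_mem_of_exposed {u : X}
    (hu : ∀ f ∈ dualCone (Ω : Set X), f ≠ 0 → 0 < inner ℝ f u) {G E : ClosedSubset X}
    (hG : G ∈ faces Ω) {e : X} (he : e ∈ dualCone (G : Set X))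
    (hE : ∀ g, g ∈ (E : Set X) ↔ g ∈ (G : Set X) ∧ inner ℝ g e = 0)
    {S : Set (ClosedSubset X)} (hS : IsClosed S)
    (h : ∀ y ∈ dualCone (G : Set X), subDual y (G : Set X) ∈ S) {x : X}
    (hx : x ∈ dualCone (E : Set X)) : subDual x (E : Set X) ∈ S := by
  have hex : ∀ k : ℕ, ∃ t ≥ (k : ℝ), x + (1 / ((k : ℝ) + 1)) • u + t • e ∈ dualCone (G : Set X) := by
    refine fun k => exists_add_smul_mem_dualCone (isCone_face hG) he (fun f hf hfe h0 => ?_) k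
    rw [inner_add_right, inner_smul_right]
    exact add_pos_of_nonneg_of_pos (mem_dualCone.1 hx f ((hE f).2 ⟨hf, hfe⟩))
      (mul_pos (by positivity) (hu f (face_subset hG hf) h0))
  choose t htk ht using hex
  have htop : Tendsto t (hyperfilter ℕ) atTop :=
    (tendsto_atTop_mono htk tendsto_natCast_atTop_atTop).mono_left Nat.hyperfilter_le_atTop
  have hw : Tendsto (fun k : ℕ => x + (1 / ((k : ℝ) + 1)) • u) (hyperfilter ℕ) (𝓝 x) := by
    have h1 := (tendsto_one_div_add_atTop_nhds_zero_nat (𝕜 := ℝ)).mono_left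
      Nat.hyperfilter_le_atTop
    simpa using (h1.smul_const u).const_add x
  have hepi : limitSet (hyperfilter ℕ) (fun k : ℕ =>
      epi (x + (1 / ((k : ℝ) + 1)) • u + t k • e) (G : Set X)) = epi x (E : Set X) := by
    ext ⟨f, s⟩
    rw [mem_limitSet_epi (F := fun _ => G)]
    constructor
    · rintro ⟨g, r, hgr, hg, hr⟩
      have hfG : f ∈ (G : Set X) := G.isClosed.mem_of_tendsto hg (hgr.mono fun k hk => hk.1)
      have hfe : inner ℝ f e ≤ 0 := by
        refine nonpos_of_mul_le htop (hg.inner tendsto_const_nhds) (hr.sub (hg.inner hw)) ?_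
        filter_upwards [hgr] with k hk
        have := hk.2
        rw [inner_add_right _ _ (t k • e), inner_smul_right _ e] at this
        linarith
      refine ⟨(hE f).2 ⟨hfG, le_antisymm hfe (mem_dualCone.1 he f hfG)⟩, ?_⟩
      refine le_of_tendsto_of_tendsto (hg.inner hw) hr ?_
      filter_upwards [hgr, htop.eventually_ge_atTop 0] with k hk h0
      have := hk.2
      rw [inner_add_right _ _ (t k • e), inner_smul_right _ e] at this
      linarith [mul_nonneg h0 (mem_dualCone.1 he _ hk.1)]
    · rintro ⟨hf, hfs⟩
      have hfs' : inner ℝ f x ≤ s := hfs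
      obtain ⟨hfG, hfe⟩ := (hE f).1 hf
      refine ⟨fun _ => f, fun k => s + (inner ℝ f (x + (1 / ((k : ℝ) + 1)) • u) - inner ℝ f x),
        Eventually.of_forall fun k => ⟨hfG, ?_⟩, tendsto_const_nhds, ?_⟩
      · rw [inner_add_right _ _ (t k • e), inner_smul_right _ e, hfe]
        linarith
      · have := (((tendsto_const_nhds (x := f)).inner hw).sub_const (inner ℝ f x)).const_add s
        simpa using this
  exact hS.mem_of_tendsto (tendsto_subDual (F := fun _ => G) (Eventually.of_forall fun _ => hG)
    (Eventually.of_forall ht) hepi) (Eventually.of_forall fun k => h _ (ht k))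

theorem eta_eq_subDual (x : X) : eta Ω x = subDual x (dualCone (Ω : Set X)) := by
  apply ClosedSubset.ext
  change (fun y => x - y) '' (Ω : Set X) = (fun y => x - y) '' dualCone (dualCone (Ω : Set X))
  rw [(isCone_properCone Ω).dualCone_dualCone Ω.isClosed]

/-- Descent on the dimension of a face G containing F, from G = Ω^*, where the sets y - G^* are the
points of Ω themselves, down to G = F. -/
theorem subDual_mem_compactification (hsolid : (Ω : Set X) - (Ω : Set X) = Set.univ)
    {F : ClosedSubset X} (hF : F ∈ faces Ω) {x : X} (hx : x ∈ dualCone (F : Set X)) :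
    subDual x (F : Set X) ∈ compactification Ω := by
  obtain ⟨u, hu⟩ := exists_inner_pos_of_solid hsolid
  have key : ∀ m, ∀ G ∈ faces Ω, setDim (G : Set X) = m → (F : Set X) ⊆ G →
      (∀ y ∈ dualCone (G : Set X), subDual y (G : Set X) ∈ compactification Ω) →
      subDual x (F : Set X) ∈ compactification Ω := by
    intro m
    induction m using Nat.strong_induction_on with
    | _ m ih =>
      intro G hG hm hFG h
      by_cases hne : (G : Set X) ⊆ F
      · rw [hFG.antisymm hne] at hx ⊢
        exact h x hx
      obtain ⟨e, he, heF, g, hg, hge⟩ := exists_exposing hF hG hFG hne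
      obtain ⟨E, hE, hEiff⟩ := exposed_mem_faces hG he
      have hEG : (E : Set X) ⊆ G := fun a ha => ((hEiff a).1 ha).1
      refine ih (setDim (E : Set X)) ?_ E hE rfl (fun f hf => (hEiff f).2 ⟨hFG hf, heF f hf⟩)
        fun y hy => subDual_mem_of_exposed hu hG he hEiff isClosed_closure h hy
      rw [← hm]
      by_contra hle
      push Not at hle
      exact hge ((hEiff g).1 (face_subset_of_setDim_le hE (face_subset hG) hEG hle hg)).2
  refine key _ _ dualCone_mem_faces rfl (face_subset hF) fun y hy => ?_
  have hy' : y ∈ (Ω : Set X) := by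
    rw [← (isCone_properCone Ω).dualCone_dualCone Ω.isClosed]
    exact hy
  exact subset_closure ⟨y, hy', eta_eq_subDual y⟩

/-- Moving from `g` in the direction `-u` one reaches a face of smaller dimension. -/
theorem exists_boundary_face {G : ClosedSubset X} (hG : G ∈ faces Ω) {g u x : X}
    (hg : g ∈ (G : Set X)) (hu : u ∈ (G : Set X)) (hx : x ∈ dualCone (G : Set X))
    (hux : 0 < inner ℝ u x) :
    ∃ s : ℝ, 0 ≤ s ∧ s * inner ℝ u x ≤ inner ℝ g x ∧ ∃ H ∈ faces Ω, g - s • u ∈ (H : Set X) ∧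
      (H : Set X) ⊆ G ∧ setDim (H : Set X) < setDim (G : Set X) := by
  let S : Set ℝ := {s | 0 ≤ s ∧ g - s • u ∈ (G : Set X)}
  have hbd : ∀ s, g - s • u ∈ (G : Set X) → s * inner ℝ u x ≤ inner ℝ g x := fun s hs => by
    have := mem_dualCone.1 hx _ hs
    rw [inner_sub_left, real_inner_smul_left] at this
    linarith
  have hScl : IsClosed S := isClosed_Ici.inter (G.isClosed.preimage
    (f := fun s : ℝ => g - s • u) (by fun_prop))
  have hSc : IsCompact S := by
    refine (isCompact_Icc (a := (0 : ℝ)) (b := inner ℝ g x / inner ℝ u x)).of_isClosed_subset hScl ?_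
    exact fun s hs => ⟨hs.1, (le_div_iff₀ hux).2 (hbd s hs.2)⟩
  obtain ⟨s, ⟨hs0, hs⟩, hmax⟩ := hSc.exists_isGreatest ⟨0, le_rfl, by simpa using hg⟩
  -- The minimal face through the last point g - s • u in G. If it had full dimension it would
  -- contain u, and one could move further.
  obtain ⟨H, hH, hHiff⟩ := exists_minimal_face (face_subset hG hs)
  have hHG : (H : Set X) ⊆ G := fun a ha => by
    obtain ⟨haK, ε, hε, hm⟩ := (hHiff a).1 ha
    exact mem_face_of_sub_smul_mem hG hε hs haK hm
  refine ⟨s, hs0, hbd s hs, H, hH, (hHiff _).2 ⟨face_subset hG hs, 1, one_pos, ?_⟩, hHG, ?_⟩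
  · rw [one_smul, sub_self]
    exact (isCone_dualCone _).zero_mem
  · by_contra hle
    push Not at hle
    have huH := face_subset_of_setDim_le hH (face_subset hG) hHG hle hu
    obtain ⟨-, ε, hε, hm⟩ := (hHiff u).1 huH
    have h1 : g - s • u - ε • u ∈ (G : Set X) := left_mem_face hG hm
      ((isCone_dualCone _).smul_mem hε.le (face_subset hG hu)) (by simpa using hs)
    rw [sub_sub, ← add_smul] at h1
    have := hmax ⟨by positivity, h1⟩
    linarith

/-- If families of faces converge, with their dimensions, to faces, then the epigraphs over
faces of linear forms in the dual cone converge to such epigraphs. -/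
theorem exists_limitSet_epi {𝒰 : Ultrafilter ι}
    (hlim : ∀ F : ι → ClosedSubset X, (∀ᶠ i in 𝒰, F i ∈ faces Ω) → ∃ E ∈ faces Ω,
      limitSet 𝒰 (fun i => (F i : Set X)) = E ∧
        ∀ᶠ i in 𝒰, setDim (F i : Set X) = setDim (E : Set X)) (m : ℕ) :
    ∀ (F : ι → ClosedSubset X) (x : ι → X), (∀ᶠ i in 𝒰, F i ∈ faces Ω) →
      (∀ᶠ i in 𝒰, setDim (F i : Set X) < m) → (∀ᶠ i in 𝒰, x i ∈ dualCone (F i : Set X)) →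
      ∃ E ∈ faces Ω, ∃ y ∈ relDualCone (E : Set X),
        limitSet 𝒰 (fun i => epi (x i) (F i : Set X)) = epi y (E : Set X) := by
  have := FiniteDimensional.proper_real X
  induction m with
  -- The dimension bound is strict, so the base case is vacuous.
  | zero =>
    intro F x _ hm
    obtain ⟨i, hi⟩ := hm.exists
    exact absurd hi (Nat.not_lt_zero _)
  | succ m ih =>
    intro F x₀ hF hm hx₀
    have hex : ∀ i, ∃ y : X, x₀ i ∈ dualCone (F i : Set X) → y ∈ relDualCone (F i : Set X) ∧
        epi (x₀ i) (F i : Set X) = epi y (F i : Set X) := by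
      intro i
      by_cases hi : x₀ i ∈ dualCone (F i : Set X)
      · obtain ⟨y, hy, h⟩ := exists_mem_relDualCone hi
        exact ⟨y, fun _ => ⟨hy, epi_congr h⟩⟩
      · exact ⟨0, fun h => absurd h hi⟩
    choose x hx using hex
    have hxr : ∀ᶠ i in 𝒰, x i ∈ relDualCone (F i : Set X) := hx₀.mono fun i hi => (hx i hi).1
    have hepi : limitSet 𝒰 (fun i => epi (x₀ i) (F i : Set X)) =
        limitSet 𝒰 (fun i => epi (x i) (F i : Set X)) :=
      (limitSet_mono (hx₀.mono fun i hi => (hx i hi).2.le)).antisymm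
        (limitSet_mono (hx₀.mono fun i hi => (hx i hi).2.ge))
    rw [hepi]
    obtain ⟨E, hE, hFE, hdim⟩ := hlim F hF
    rcases bounded_or_tendsto_atTop 𝒰 fun i => ‖x i‖ with ⟨R, hR⟩ | htop
    · obtain ⟨y, hy⟩ := exists_tendsto_of_bounded hR
      exact ⟨E, hE, y, mem_relDualCone_of_tendsto hFE hdim hxr hy, limitSet_epi_of_tendsto hFE hy⟩
    obtain ⟨v, hv1, hv⟩ := exists_direction htop
    -- Unbounded case: along approximants u i of u₀ the forms ⟨u i, x i⟩ tend to infinity.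
    obtain ⟨u₀, hu₀, hpos⟩ := exists_inner_pos (direction_mem_relDualCone hFE hdim hxr hv) (by
      rintro rfl
      simp at hv1)
    rw [← hFE] at hu₀
    obtain ⟨u, hu, huu₀⟩ := mem_limitSet_closedSubset.1 hu₀
    have hux : Tendsto (fun i => inner ℝ (u i) (x i)) 𝒰 atTop := by
      refine (htop.atTop_mul_pos hpos (huu₀.inner hv)).congr' ?_
      filter_upwards [htop.eventually_gt_atTop 0] with i hi
      rw [inner_smul_right, mul_inv_cancel_left₀ hi.ne']
    set L := limitSet 𝒰 (fun i => epi (x i) (F i : Set X)) with hL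
    have hLadd : ∀ {f g : X} {s t : ℝ}, (f, s) ∈ L → (g, t) ∈ L → (f + g, s + t) ∈ L := by
      intro f g s t hf hg
      obtain ⟨a, p, h1, h2, h3⟩ := mem_limitSet_epi.1 hf
      obtain ⟨b, q, h4, h5, h6⟩ := mem_limitSet_epi.1 hg
      refine mem_limitSet_epi.2 ⟨fun i => a i + b i, fun i => p i + q i, ?_, h2.add h5, h3.add h6⟩
      filter_upwards [hF, h1, h4] with i hi h1 h4
      exact ⟨(isCone_face hi).add_mem h1.1 h4.1, by
        rw [inner_add_left]
        exact add_le_add h1.2 h4.2⟩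
    have hLsmul : ∀ {f : X} {s c : ℝ}, 0 ≤ c → (f, s) ∈ L → (c • f, c * s) ∈ L := by
      intro f s c hc hf
      obtain ⟨a, p, h1, h2, h3⟩ := mem_limitSet_epi.1 hf
      refine mem_limitSet_epi.2 ⟨fun i => c • a i, fun i => c * p i, ?_, h2.const_smul c,
        h3.const_mul c⟩
      filter_upwards [hF, h1] with i hi h1
      exact ⟨(isCone_face hi).smul_mem hc h1.1, by
        rw [real_inner_smul_left]
        exact mul_le_mul_of_nonneg_left h1.2 hc⟩
    have hLzero : ((0 : X), (0 : ℝ)) ∈ L := mem_limitSet_epi.2 ⟨fun _ => 0, fun _ => 0,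
      hF.mono fun i hi => ⟨(isCone_face hi).zero_mem, by simp⟩, tendsto_const_nhds,
      tendsto_const_nhds⟩
    have hLnonneg : ∀ {f : X} {s : ℝ}, (f, s) ∈ L → 0 ≤ s := by
      intro f s hf
      obtain ⟨a, p, h1, -, h3⟩ := mem_limitSet_epi.1 hf
      exact ge_of_tendsto h3 ((h1.and hxr).mono fun i hi =>
        (mem_dualCone.1 hi.2.2 _ hi.1.1).trans hi.1.2)
    have hLK : ∀ {f : X} {s : ℝ}, (f, s) ∈ L → f ∈ dualCone (Ω : Set X) := by
      intro f s hf
      obtain ⟨a, p, h1, h2, -⟩ := mem_limitSet_epi.1 hf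
      exact (isClosed_dualCone _).mem_of_tendsto h2 ((hF.and h1).mono fun i hi =>
        face_subset hi.1 hi.2.1)
    have hD : IsCone {f : X | ∃ s, (f, s) ∈ L} :=
      ⟨⟨0, hLzero⟩, fun ⟨_, hs⟩ ⟨_, ht⟩ => ⟨_, hLadd hs ht⟩, fun hc ⟨_, hs⟩ => ⟨_, hLsmul hc hs⟩⟩
    -- L is a convex cone in X × ℝ. It is enough to reach its lowest point (f, t) above a core point
    -- f of its domain from smaller faces.
    obtain ⟨f, ⟨s₁, hs₁⟩, hcore⟩ := hD.exists_core
    obtain ⟨t, htL, htmin⟩ : ∃ t, (f, t) ∈ L ∧ ∀ s, (f, s) ∈ L → t ≤ s := by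
      have hcl : IsClosed {s : ℝ | (f, s) ∈ L} :=
        (isClosed_limitSet _ _).preimage (f := fun s : ℝ => (f, s)) (by fun_prop)
      have hbdd : BddBelow {s : ℝ | (f, s) ∈ L} := ⟨0, fun s hs => hLnonneg hs⟩
      exact ⟨_, hcl.csInf_mem ⟨s₁, hs₁⟩ hbdd, fun s hs => csInf_le hbdd hs⟩
    obtain ⟨g, τ, hgτ, hg, hτ⟩ := mem_limitSet_epi.1 htL
    have hex : ∀ i, ∃ (s : ℝ) (H : ClosedSubset X), F i ∈ faces Ω → g i ∈ (F i : Set X) →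
        u i ∈ (F i : Set X) → x i ∈ dualCone (F i : Set X) → 0 < inner ℝ (u i) (x i) →
        0 ≤ s ∧ s * inner ℝ (u i) (x i) ≤ inner ℝ (g i) (x i) ∧ H ∈ faces Ω ∧
        g i - s • u i ∈ (H : Set X) ∧ (H : Set X) ⊆ F i ∧
        setDim (H : Set X) < setDim (F i : Set X) := by
      intro i
      by_cases h : F i ∈ faces Ω ∧ g i ∈ (F i : Set X) ∧ u i ∈ (F i : Set X) ∧
          x i ∈ dualCone (F i : Set X) ∧ 0 < inner ℝ (u i) (x i)
      · obtain ⟨h1, h2, h3, h4, h5⟩ := h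
        obtain ⟨s, hs0, hs, H, hH, hgH, hHF, hlt⟩ := exists_boundary_face h1 h2 h3 h4 h5
        exact ⟨s, H, fun _ _ _ _ _ => ⟨hs0, hs, hH, hgH, hHF, hlt⟩⟩
      · exact ⟨0, F i, fun h1 h2 h3 h4 h5 => absurd ⟨h1, h2, h3, h4, h5⟩ h⟩
    choose s H hsH using hex
    have hH : ∀ᶠ i in 𝒰, 0 ≤ s i ∧ s i * inner ℝ (u i) (x i) ≤ inner ℝ (g i) (x i) ∧
        H i ∈ faces Ω ∧ g i - s i • u i ∈ (H i : Set X) ∧ (H i : Set X) ⊆ F i ∧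
        setDim (H i : Set X) < setDim (F i : Set X) := by
      filter_upwards [hF, hgτ, hu, hxr, hux.eventually_gt_atTop 0] with i h1 h2 h3 h4 h5
      exact hsH i h1 h2.1 h3 h4.2 h5
    -- s i is at most τ i / ⟨u i, x i⟩, with bounded numerator and infinite denominator; so moving g
    -- i into the smaller face H i does not change its limit f.
    have hs : Tendsto s 𝒰 (𝓝 0) := by
      refine tendsto_of_tendsto_of_tendsto_of_le_of_le' tendsto_const_nhds (hτ.div_atTop hux)
        (hH.mono fun i hi => hi.1) ?_
      filter_upwards [hH, hgτ, hux.eventually_gt_atTop 0] with i h1 h2 h3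
      exact (le_div_iff₀ h3).2 (h1.2.1.trans h2.2)
    have hh : Tendsto (fun i => g i - s i • u i) 𝒰 (𝓝 f) := by
      simpa using hg.sub (hs.smul huu₀)
    obtain ⟨E', hE', y, hy, hlim'⟩ := ih H x (hH.mono fun i hi => hi.2.2.1)
      ((hH.and hm).mono fun i hi => by
        have := hi.1.2.2.2.2.2
        omega)
      ((hH.and hxr).mono fun i hi => dualCone_anti hi.1.2.2.2.2.1 hi.2.2)
    have hsub : epi y (E' : Set X) ⊆ L := by
      rw [← hlim']
      exact limitSet_mono (hH.mono fun i hi p hp => ⟨hi.2.2.2.2.1 hp.1, hp.2⟩)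
    have hft : (f, t) ∈ epi y (E' : Set X) := by
      rw [← hlim', mem_limitSet_epi]
      refine ⟨_, τ, ?_, hh, hτ⟩
      filter_upwards [hH, hgτ, hux.eventually_gt_atTop 0] with i h1 h2 h3
      refine ⟨h1.2.2.2.1, ?_⟩
      rw [inner_sub_left, real_inner_smul_left]
      linarith [mul_nonneg h1.1 h3.le, h2.2]
    refine ⟨E', hE', y, hy, Set.Subset.antisymm ?_ hsub⟩
    rintro ⟨a, r⟩ har
    -- f lies in the face E', so its summands ε • a and f - ε • a do too. A value r below ⟨a, y⟩
    -- would produce a point of L above f lower than t.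
    obtain ⟨ε, hε, r', hr'⟩ := hcore a (Submodule.subset_span ⟨r, har⟩)
    have haE : a ∈ (E' : Set X) := mem_face_of_sub_smul_mem hE' hε hft.1 (hLK har) (hLK hr')
    have hbE : f - ε • a ∈ (E' : Set X) := left_mem_face hE' (hLK hr')
      ((isCone_dualCone _).smul_mem hε.le (hLK har)) (by simpa using hft.1)
    have h1 := hLadd (hsub (show (f - ε • a, inner ℝ (f - ε • a) y) ∈ epi y (E' : Set X) from
      ⟨hbE, le_rfl⟩)) (hLsmul hε.le har)
    rw [sub_add_cancel] at h1
    have h2 := htmin _ h1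
    have h3 : inner ℝ f y ≤ t := hft.2
    rw [inner_sub_left, real_inner_smul_left] at h2
    exact ⟨haE, le_of_mul_le_mul_left (by linarith) hε⟩

variable {d : ℕ} {n : Fin (d + 1) → ℕ}

theorem compactification_eq_U (hsolid : (Ω : Set X) - (Ω : Set X) = Set.univ)
    (hdims : Set.range n = faceDims Ω) (h : ∀ j, IsCompact (faceStratum Ω n j)) :
    compactification Ω = U Ω n (d + 1) := by
  have := FiniteDimensional.proper_real X
  refine Set.Subset.antisymm (fun A hA => ?_) fun A hA => ?_
  swap
  · obtain ⟨F, hF, x, hx, rfl⟩ := (mem_U_iff hdims).1 hA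
    exact subDual_mem_compactification hsolid hF hx.2
  obtain ⟨𝒰, himage, hle⟩ := mem_closure_iff_ultrafilter.1 hA
  have hlim : ∀ F : ClosedSubset X → ClosedSubset X, (∀ᶠ B in 𝒰, F B ∈ faces Ω) →
      ∃ E ∈ faces Ω, limitSet 𝒰 (fun B => (F B : Set X)) = E ∧
        ∀ᶠ B in 𝒰, setDim (F B : Set X) = setDim (E : Set X) := by
    intro F hF
    have h1 : ∀ᶠ B in 𝒰, ∃ j ∈ (Set.univ : Set (Fin (d + 1))), F B ∈ faceStratum Ω n j := by
      filter_upwards [hF] with B hB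
      obtain ⟨j, hj⟩ : setDim (F B : Set X) ∈ Set.range n := hdims ▸ ⟨F B, hB, rfl⟩
      exact ⟨j.rev, trivial, hB, by rw [Fin.rev_rev, hj]⟩
    -- There are finitely many strata, so the ultrafilter selects one; its compactness keeps the
    -- dimension in the limit.
    obtain ⟨j, -, hj⟩ := (Ultrafilter.eventually_exists_mem_iff Set.finite_univ).1 h1
    obtain ⟨E, hE, hE'⟩ := (h j).ultrafilter_le_nhds (𝒰.map F) (le_principal_iff.2 hj)
    exact ⟨E, hE.1, tendsto_fell_iff.1 hE', hj.mono fun B hB => hB.2.trans hE.2.symm⟩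
  have hex : ∀ B : ClosedSubset X, ∃ x : X, B ∈ eta Ω '' (Ω : Set X) →
      x ∈ (Ω : Set X) ∧ eta Ω x = B := by
    intro B
    by_cases hB : B ∈ eta Ω '' (Ω : Set X)
    · obtain ⟨x, hx⟩ := hB
      exact ⟨x, fun _ => hx⟩
    · exact ⟨0, fun h => absurd h hB⟩
  choose x hx using hex
  let K : ClosedSubset X := ⟨dualCone (Ω : Set X), isClosed_dualCone _⟩
  have hK : ∀ᶠ _ in (𝒰 : Filter (ClosedSubset X)), K ∈ faces Ω := Eventually.of_forall fun _ => dualCone_mem_faces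
  have hxK : ∀ᶠ B in 𝒰, x B ∈ dualCone (K : Set X) := by
    filter_upwards [himage] with B hB
    have h1 := (hx B hB).1
    rwa [← (isCone_properCone Ω).dualCone_dualCone Ω.isClosed] at h1
  obtain ⟨E, hE, y, hy, hepi⟩ := exists_limitSet_epi hlim (setDim (K : Set X) + 1) (fun _ => K) x hK
    (Eventually.of_forall fun _ => Nat.lt_succ_self _) hxK
  have ht := tendsto_subDual (F := fun _ => K) hK hxK hepi
  have hA' : Tendsto (fun B => subDual (x B) (K : Set X)) 𝒰 (𝓝 A) := by
    refine (show Tendsto id 𝒰 (𝓝 A) from hle).congr' ?_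
    filter_upwards [himage] with B hB
    exact (hx B hB).2.symm.trans (eta_eq_subDual _)
  exact (mem_U_iff hdims).2 ⟨E, hE, y, hy, fell_tendsto_unique hA' ht⟩

end Closure

end WienerHopf

theorem mainTheorem4 {X : Type*} [NormedAddCommGroup X] [InnerProductSpace ℝ X]
    [FiniteDimensional ℝ X] (Ω : ProperCone ℝ X)
    (hpointed : -(Ω : Set X) ∩ (Ω : Set X) = {0})
    (hsolid : (Ω : Set X) - (Ω : Set X) = Set.univ)
    (d : ℕ) (n : Fin (d + 1) → ℕ) (hn : StrictMono n)
    (hdims : Set.range n = WienerHopf.faceDims Ω) :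
    (WienerHopf.compactification Ω = WienerHopf.U Ω n (d + 1) →
      IsCompact (WienerHopf.faces Ω)) ∧
    (IsCompact (WienerHopf.faces Ω) →
      ∀ j : Fin (d + 1), ContinuousOn
        (fun A : WienerHopf.U Ω n (d + 1) =>
          (WienerHopf.facePi Ω n A, WienerHopf.pointLambda Ω n A))
        {A | A.1 ∈ WienerHopf.Y Ω n j}) ∧
    ((∀ j : Fin (d + 1), IsCompact (WienerHopf.faceStratum Ω n j)) →
      WienerHopf.compactification Ω = WienerHopf.U Ω n (d + 1)) := by
  exact ⟨WienerHopf.isCompact_faces hdims, WienerHopf.continuousOn_facePi_pointLambda,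
    WienerHopf.compactification_eq_U hsolid hdims⟩
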